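/- **Theorem.** Let $\xi\in(0,1)$ and let $f:[0,1]\to\mathbb R$ be such that its $1$-periodic extension is analytic off $\xi+\mathbb Z$ and has at most a jump there; precisely, on $(\xi,\xi+1)$ the periodic extension coincides with a function analytic in a neighbourhood of $[\xi,\xi+1]$ (so $f(0)=f(1)$; the value $f(\xi)$ is arbitrary). For $x\in[0,1]$ let $d(x)=\min(|x-\xi|,\,1-|x-\xi|)$ be the distance on the circle $\mathbb R/\mathbb Z$ from $x$ to the jump, and let $\|f\|_\infty$ be the essential supremum of $|f|$ on $[0,1]$. *Notation.* Put $\langle g,h\rangle=\int_0^1 g\,\overline{h}$, $\phi_l(x)=e^{2\pi i l x}$ ($l\in\mathbb Z$), and for real frequencies $(\lambda_j)_{j\in\mathbb Z}$ put $\psi_j(x)=e^{2\pi i\lambda_j x}$. For $g \in L^2[0,1]$ let $S_m g=\sum_{|j|\le m}\langle g,\psi_j\rangle\psi_j$, let $\mathcal G_n=\operatorname{span}\{\phi_l:|l|\le n\}$, let $Q_n g=\sum_{|l|\le n}\langle g,\phi_l\rangle\phi_l$ be the orthogonal projection onto $\mathcal G_n$, and let $W_n=Q_nS_m|_{\mathcal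 G_n}:\mathcal G_n\to\mathcal G_n$. With $H_k$ the (physicists') Hermite polynomials, let $$\mathbf H_{p,\gamma}(x)=\frac1\gamma e^{-x^2/(2\gamma^2)}\sum_{l=0}^p\frac{(-1)^l}{4^l\,l!}H_{2l}\Bigl(\frac{x}{\sqrt2\,\gamma}\Bigr),\qquad \rho_{p,\gamma}(x)=\sqrt{2\pi}\,m\sum_{k\in\mathbb Z}\mathbf H_{p,\gamma}\bigl(2\pi m(x+k)\bigr),$$ so that the $j$-th Fourier coefficient of the $1$-periodic mollifier $\rho_{p,\gamma}$ is $\sigma_{p,\gamma}(j/m)$ with $\sigma_{p,\gamma}(w)=e^{-(w\gamma)^2/2}\sum_{l=0}^p\frac{(w\gamma)^{2l}}{2^l\,l!}$; let $(\rho_{p,\gamma}*f)(x)=\int_0^1\rho_{p,\gamma}(x-y)f(y)\,dy$. *Claim.* There are constants $C_f>0$ and $\eta_f>1$, depending only on $f$ and $\xi$, such that the following holds. Let $\{\psi_j\}_{j\in\mathbb Z}$ be a frame of $L^2[0,1]$ with bounds $A,B>0$, that is, $A\|g\|_2^2\le\sum_{j\in\mathbb Z}|\langle g,\psi_j\rangle|^2\le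 B\|g\|_2^2$ for all $g\in L^2[0,1]$, which is admissible with respect to the Fourier basis: $|\langle\psi_j,\phi_l\rangle|\le c_0(1+|j-l|)^{-1}$ for all $j,l\in\mathbb Z$, with $c_0>0$. Let $\alpha,\kappa>0$ satisfy $$\alpha\kappa<\frac1{2\ln(1+\sqrt2)},\qquad \frac\kappa\alpha\le\frac{A^2}{2(A+2c_0^2)^2}.$$ Let $m\in\mathbb N$ be such that $n=\bigl\lfloor\frac{Am}{A+2c_0^2}\bigr\rfloor\ge1$. Then $W_n$ is invertible, and for every $x\in[0,1]$, $x\ne\xi$, with $\gamma_x=\sqrt{\alpha\,d(x)\,m}$ and $p_x=\lfloor\kappa\,d(x)\,m\rfloor$, the filter reconstruction $$f_m^{\rm filter}(x)=\bigl(W_n^{-1}Q_nS_m(\rho_{p_x,\gamma_x}*f)\bigr)(x)$$ satisfies $$|f(x)-f_m^{\rm filter}(x)|\le C_f\,m^{9/4}\,\tau^{-m\,d(x)}+\|f\|_\infty\,\frac{A+2B}{A\sqrt{2\pi\kappa\,d(x)\,m}}\Bigl(\frac{2Am}{A+2c_0^2}+1\Bigr)e^{-(\theta-1-\ln\theta)\,\kappa\,d(x)\,m},$$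 where $\tau=\min\Bigl(\eta_f^{\kappa},\ \dfrac{e^{1/(4\alpha)}}{(1+\sqrt2)^{\kappa}}\Bigr)$ and $\theta=\dfrac{\alpha A^2}{2\kappa(A+2c_0^2)^2}$. -/

import Mathlib

open MeasureTheory

noncomputable section

namespace FourierRecon

/-- The exponential `x ↦ e^{2πi t x}` of frequency `t`. The Fourier basis is `φ_l = expo l` and the
non-uniform system is `ψ_j = expo (lam j)`. -/
def expo (t : ℝ) : ℝ → ℂ := fun x => Complex.exp (2 * Real.pi * Complex.I * t * x)

/-- The inner product `⟨g, h⟩ = ∫₀¹ g(x) h(x)^* dx` of `L²[0,1]`. -/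
def ip (g h : ℝ → ℂ) : ℂ := ∫ x in (0 : ℝ)..1, g x * (starRingEnd ℂ) (h x)

/-- `{ψ_j}` is a frame of `L²[0,1]` with lower and upper frame bounds `A`, `B`. -/
def IsFourierFrame (lam : ℤ → ℝ) (A B : ℝ) : Prop :=
  0 < A ∧ 0 < B ∧ ∀ g : ℝ → ℂ, MemLp g 2 (volume.restrict (Set.Icc (0 : ℝ) 1)) →
    Summable (fun j : ℤ => ‖ip g (expo (lam j))‖ ^ 2) ∧
    A * ∫ x in (0 : ℝ)..1, ‖g x‖ ^ 2 ≤ ∑' j : ℤ, ‖ip g (expo (lam j))‖ ^ 2 ∧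
    ∑' j : ℤ, ‖ip g (expo (lam j))‖ ^ 2 ≤ B * ∫ x in (0 : ℝ)..1, ‖g x‖ ^ 2

/-- Admissibility with respect to the Fourier basis:
`|⟨ψ_j, φ_l⟩| ≤ c₀ (1 + |j - l|)⁻¹` with `c₀ > 0`. -/
def IsAdmissible (lam : ℤ → ℝ) (c₀ : ℝ) : Prop :=
  0 < c₀ ∧ ∀ j l : ℤ, ‖ip (expo (lam j)) (expo l)‖ ≤ c₀ * (1 + |(j : ℝ) - l|)⁻¹

/-- `G_n = span {φ_l : |l| ≤ n}`. -/
def trigSpace (n : ℕ) : Submodule ℂ (ℝ → ℂ) :=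
  Submodule.span ℂ ((fun l : ℤ => expo l) '' Set.Icc (-(n : ℤ)) n)

theorem expo_continuous (t : ℝ) : Continuous (expo t) := by
  unfold expo
  fun_prop

theorem expo_mem_trigSpace {n : ℕ} {l : ℤ} (hl : l ∈ Finset.Icc (-(n : ℤ)) n) :
    expo l ∈ trigSpace n :=
  Submodule.subset_span ⟨l, Finset.mem_Icc.1 hl, rfl⟩

theorem continuous_of_mem_trigSpace {n : ℕ} {g : ℝ → ℂ} (hg : g ∈ trigSpace n) :
    Continuous g := by
  induction hg using Submodule.span_induction with
  | mem x hx =>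
    obtain ⟨l, -, rfl⟩ := hx
    exact expo_continuous _
  | zero => exact continuous_const
  | add x y _ _ hx hy => exact hx.add hy
  | smul a x _ hx => exact hx.const_smul a

/-- The orthogonal projection `Q_n g = ∑_{|l| ≤ n} ⟨g, φ_l⟩ φ_l` onto `G_n`. -/
def proj (n : ℕ) (g : ℝ → ℂ) : trigSpace n :=
  ⟨∑ l ∈ Finset.Icc (-(n : ℤ)) n, ip g (expo l) • expo l,
    Submodule.sum_mem _ fun _ hl => Submodule.smul_mem _ _ (expo_mem_trigSpace hl)⟩

/-- `S_m g = ∑_{|j| ≤ m} ⟨g, ψ_j⟩ ψ_j`. -/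
def partialFrame (lam : ℤ → ℝ) (m : ℕ) (g : ℝ → ℂ) : ℝ → ℂ :=
  ∑ j ∈ Finset.Icc (-(m : ℤ)) m, ip g (expo (lam j)) • expo (lam j)

theorem ip_add {g h k : ℝ → ℂ} (hg : Continuous g) (hh : Continuous h) (hk : Continuous k) :
    ip (g + h) k = ip g k + ip h k := by
  have hk' : Continuous fun x => (starRingEnd ℂ) (k x) := Complex.continuous_conj.comp hk
  unfold ip
  have h1 := intervalIntegral.integral_add (μ := volume) (a := 0) (b := 1)
    ((hg.mul hk').intervalIntegrable 0 1) ((hh.mul hk').intervalIntegrable 0 1)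
  simp only [Pi.mul_apply] at h1
  rw [← h1]
  simp only [Pi.add_apply, add_mul]

theorem ip_smul (a : ℂ) (g k : ℝ → ℂ) : ip (a • g) k = a * ip g k := by
  unfold ip
  rw [← intervalIntegral.integral_const_mul]
  simp [mul_assoc]

theorem partialFrame_continuous (lam : ℤ → ℝ) (m : ℕ) (g : ℝ → ℂ) :
    Continuous (partialFrame lam m g) := by
  unfold partialFrame
  refine Finset.sum_induction _ (fun h : ℝ → ℂ => Continuous h)
    (fun _ _ ha hb => ha.add hb) continuous_const ?_
  intro j _
  exact (expo_continuous _).const_smul _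

/-- The operator `W_n = Q_n S_m` restricted to `G_n`. -/
def frameOp (lam : ℤ → ℝ) (m n : ℕ) : Module.End ℂ (trigSpace n) where
  toFun g := proj n (partialFrame lam m g)
  map_add' g h := by
    have e : partialFrame lam m ((g + h : trigSpace n) : ℝ → ℂ)
        = partialFrame lam m g + partialFrame lam m h := by
      unfold partialFrame
      rw [← Finset.sum_add_distrib]
      refine Finset.sum_congr rfl fun j _ => ?_
      rw [Submodule.coe_add, ip_add (continuous_of_mem_trigSpace g.2)
        (continuous_of_mem_trigSpace h.2) (expo_continuous _), add_smul]
    apply Subtype.ext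
    rw [e, Submodule.coe_add]
    unfold proj
    simp only
    rw [← Finset.sum_add_distrib]
    refine Finset.sum_congr rfl fun l _ => ?_
    rw [ip_add (partialFrame_continuous _ _ _) (partialFrame_continuous _ _ _)
      (expo_continuous _), add_smul]
  map_smul' a g := by
    have e : partialFrame lam m ((a • g : trigSpace n) : ℝ → ℂ)
        = a • partialFrame lam m g := by
      unfold partialFrame
      rw [Finset.smul_sum]
      refine Finset.sum_congr rfl fun j _ => ?_
      rw [Submodule.coe_smul, ip_smul, mul_smul]
    apply Subtype.ext
    rw [e, RingHom.id_apply, Submodule.coe_smul]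
    unfold proj
    simp only
    rw [Finset.smul_sum]
    refine Finset.sum_congr rfl fun l _ => ?_
    rw [ip_smul, mul_smul]

/-- The physicists' Hermite polynomial `H_k(x) = 2^{k/2} He_k(√2 x)`; Mathlib's
`Polynomial.hermite k` is the probabilists' one, `He_k`. -/
def physHermite (k : ℕ) (x : ℝ) : ℝ :=
  (√2) ^ k * Polynomial.aeval (√2 * x) (Polynomial.hermite k)

/-- The Hermite distributed approximating functional of order `p` with localization `γ`. -/
def hdaf (p : ℕ) (γ x : ℝ) : ℝ :=
  1 / γ * Real.exp (-(x / (√2 * γ)) ^ 2) *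
    ∑ l ∈ Finset.range (p + 1),
      (-1) ^ l / (4 ^ l * (l.factorial : ℝ)) * physHermite (2 * l) (x / (√2 * γ))

/-- The `1`-periodic mollifier `ρ_{p,γ}` built from the HDAF. The normalization is the one for which
the `j`-th Fourier coefficient of `ρ_{p,γ}` is `σ_{p,γ}(j/m)`, where
`σ_{p,γ}(w) = e^{-(wγ)²/2} ∑_{l ≤ p} (wγ)^{2l} / (2^l l!)` is the HDAF filter, i.e. mollification is
the same as filtering the Fourier coefficients. -/
def mollifier (m p : ℕ) (γ x : ℝ) : ℝ :=
  √(2 * Real.pi) * m * ∑' k : ℤ, hdaf p γ (2 * Real.pi * m * (x + k))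

/-- The convolution `(ρ_{p,γ} * f)(x) = ∫₀¹ ρ_{p,γ}(x - y) f(y) dy`. -/
def mollify (m p : ℕ) (γ : ℝ) (f : ℝ → ℝ) : ℝ → ℂ :=
  fun x => ((∫ y in (0 : ℝ)..1, mollifier m p γ (x - y) * f y : ℝ) : ℂ)

/-- The distance, on the circle `ℝ/ℤ`, from `x ∈ [0,1]` to the jump `ξ ∈ (0,1)`. -/
def jumpDist (ξ x : ℝ) : ℝ := min |x - ξ| (1 - |x - ξ|)

/-- `f`, given on `[0,1]` and extended `1`-periodically, is analytic off `ξ + ℤ` with at most a jump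
there: on the period `(ξ, ξ + 1)` it agrees with a function that is analytic in a neighbourhood of
the closed interval `[ξ, ξ + 1]`. The value of `f` at `ξ` is arbitrary. -/
def IsPiecewiseAnalytic (f : ℝ → ℝ) (ξ : ℝ) : Prop :=
  ∃ g : ℝ → ℝ, AnalyticOnNhd ℝ g (Set.Icc ξ (ξ + 1)) ∧
    (∀ x ∈ Set.Ioc ξ 1, f x = g x) ∧ ∀ x ∈ Set.Ico 0 ξ, f x = g (x + 1)

/-- `‖f‖_∞` on `[0,1]`. -/
def supNorm (f : ℝ → ℝ) : ℝ :=
  (eLpNorm f ⊤ (volume.restrict (Set.Icc (0 : ℝ) 1))).toReal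

/-- The real number `A m / (A + 2 c₀²)`. -/
def modeBound (A c₀ : ℝ) (m : ℕ) : ℝ := A * m / (A + 2 * c₀ ^ 2)

/-- The number `n` of Fourier modes, the integer part of `A m / (A + 2 c₀²)`. -/
def modes (A c₀ : ℝ) (m : ℕ) : ℕ := ⌊modeBound A c₀ m⌋₊

/-- The adaptive localization `γ_x = √(α d(x) m)`. -/
def gammaX (α ξ : ℝ) (m : ℕ) (x : ℝ) : ℝ := √(α * jumpDist ξ x * m)

/-- The adaptive order `p_x`, the integer part of `κ d(x) m`. -/
def orderX (κ ξ : ℝ) (m : ℕ) (x : ℝ) : ℕ := ⌊κ * jumpDist ξ x * m⌋₊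

/-- The filter reconstruction `f_m^{filter}(x) = (W_n⁻¹ Q_n S_m (ρ_{p_x,γ_x} * f))(x)`. Here
`Ring.inverse` is the inverse of an invertible operator (and `0` otherwise). -/
def filterRecon (lam : ℤ → ℝ) (m n : ℕ) (α κ ξ : ℝ) (f : ℝ → ℝ) (x : ℝ) : ℂ :=
  (Ring.inverse (frameOp lam m n)
    (proj n (partialFrame lam m (mollify m (orderX κ ξ m x) (gammaX α ξ m x) f))) : ℝ → ℂ) x

/-- `τ = min (η^κ, e^{1/(4α)} / (1 + √2)^κ)`. -/
def rateTau (η α κ : ℝ) : ℝ := min (η ^ κ) (Real.exp (1 / (4 * α)) / (1 + √2) ^ κ)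

/-- `θ = α A² / (2 κ (A + 2 c₀²)²)`. -/
def rateTheta (A c₀ α κ : ℝ) : ℝ := α * A ^ 2 / (2 * κ * (A + 2 * c₀ ^ 2) ^ 2)

end FourierRecon

end

/-!
The error splits as `f - f_m = (f - h) + (h - f_m)` with `h = ρ_{p,γ} * f`.

*Mollification.* The kernel is a rescaling of the function
`Φ_p(t) = e^{-t²/2} ∑_{l ≤ p} (-1)^l He_{2l}(t) / (2^l l!)` (`hermiteKernel`). By a
Christoffel–Darboux identity `t Φ_p(t)` is a multiple of the derivative of order `2p + 1` of
the Gaussian, so `Φ_p` reproduces polynomials of degree at most `2p + 1`; Cauchy's estimate for the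
entire function `e^{-w²/2}` on circles of radius `√(2l)` shows that
`|Φ_p(t)| ≤ C (p + 1)² e^{-t²/4}`, with no exponential growth in `p`. The periodic extension of `f`
is compared with a Taylor polynomial of degree less than `2N`, where `N ≈ δ κ d m` is a small
fraction of the order. Measured in units of `d`, the difference is at most `D (|z| / (b d))^{2N}` at
every real distance `z` (`exists_taylor_on_line`), and the Gaussian moment of order `2N` at the
scale `s` of the kernel is at most a constant times `(8 N s²)^N`, where `N s² / d²` is of size
`δ α κ`. As `α κ < 1`, a small `δ`, depending only on the radius of analyticity, makes the product
geometrically small in `N` (`exists_mollify_error`). This gives the rate `η^{-κ d m}` outright,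
which is at most `τ^{-d m}`.

*Reconstruction.* By Poisson summation `h` has Fourier coefficients `σ_{p,γ}(l/m) f̂(l)`. The
operator `W_n⁻¹ Q_n S_m` solves the least squares problem with samples `⟨·, ψ_j⟩`, `|j| ≤ m`, so it
is stable as soon as these samples control `G_n`. They see a quarter of the energy
(`quarter_energy_le`): the discarded samples are estimated through
`|⟨ψ_j, φ_l⟩| = |sin π(λ_j - l)| / (π |λ_j - l|)`, while admissibility at the integer nearest to
`λ_j` forces `|λ_j - j| ≤ π c₀ / 2 - 1/2`, and unit density of the frequencies forces `A ≤ 1`; the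
definition of `n` leaves just enough room. Since `A ≤ B`, the resulting stability constant
`2 √(B/A)` is at most `2B/A`. What remains is the Fourier tail of `h` beyond `n`: Chernoff's bound
for Poisson variables controls the filter, with additional Gaussian decay away from the cut-off
(`hdafFilter_le_gaussian`), and the tail is then summed by Cauchy–Schwarz in the uniform norm and by
Parseval in the `L²` norm.
-/

noncomputable section

namespace FourierRecon

/-! ### Hermite functions -/

/-- The Hermite function `He_n(t) e^{-t²/2} = (-1)^n (d/dt)^n e^{-t²/2}`. -/
def hermiteGauss (n : ℕ) (t : ℝ) : ℝ :=
  Polynomial.aeval t (Polynomial.hermite n) * Real.exp (-(t ^ 2 / 2))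

theorem hasDerivAt_hermiteGauss (n : ℕ) (t : ℝ) :
    HasDerivAt (hermiteGauss n) (-hermiteGauss (n + 1) t) t := by
  have h1 := (Polynomial.hermite n).hasDerivAt_aeval t
  have h2 : HasDerivAt (fun t : ℝ => Real.exp (-(t ^ 2 / 2)))
      (Real.exp (-(t ^ 2 / 2)) * (-t)) t := by
    have := (((hasDerivAt_id t).pow 2).div_const 2).neg.exp
    simpa using this
  refine (h1.mul h2).congr_deriv ?_
  simp only [hermiteGauss, Polynomial.hermite_succ, map_sub, map_mul, Polynomial.aeval_X]
  ring

theorem continuous_hermiteGauss (n : ℕ) : Continuous (hermiteGauss n) :=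
  continuous_iff_continuousAt.2 fun t => (hasDerivAt_hermiteGauss n t).continuousAt

theorem derivative_hermite_succ (n : ℕ) :
    Polynomial.derivative (Polynomial.hermite (n + 1))
      = ((n : Polynomial ℤ) + 1) * Polynomial.hermite n := by
  induction n with
  | zero => simp
  | succ n ih =>
    have h : Polynomial.derivative (((n : Polynomial ℤ) + 1) * Polynomial.hermite n)
        = ((n : Polynomial ℤ) + 1) * Polynomial.derivative (Polynomial.hermite n) := by
      rw [Polynomial.derivative_mul]; simp
    rw [Polynomial.hermite_succ (n + 1), Polynomial.derivative_sub, Polynomial.derivative_mul, ih,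
      h, Polynomial.derivative_X, Polynomial.hermite_succ n]
    push_cast
    ring

theorem hermiteGauss_recurrence (n : ℕ) (t : ℝ) :
    hermiteGauss (n + 2) t = t * hermiteGauss (n + 1) t - (n + 1) * hermiteGauss n t := by
  simp only [hermiteGauss]
  rw [Polynomial.hermite_succ (n + 1), derivative_hermite_succ]
  simp only [map_sub, map_mul, Polynomial.aeval_X, map_add, map_natCast, map_one]
  ring

theorem iteratedDeriv_complex_gaussian (n : ℕ) (w : ℂ) :
    iteratedDeriv n (fun w : ℂ => Complex.exp (-(w ^ 2 / 2))) w
      = (-1) ^ n * Polynomial.aeval w (Polynomial.hermite n) * Complex.exp (-(w ^ 2 / 2)) := by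
  induction n generalizing w with
  | zero => simp
  | succ n ih =>
    have e : iteratedDeriv n (fun w : ℂ => Complex.exp (-(w ^ 2 / 2)))
        = fun w => (-1) ^ n * Polynomial.aeval w (Polynomial.hermite n)
            * Complex.exp (-(w ^ 2 / 2)) := funext ih
    rw [iteratedDeriv_succ, e]
    have h1 := ((Polynomial.hermite n).hasDerivAt_aeval w).const_mul ((-1 : ℂ) ^ n)
    have h2 : HasDerivAt (fun t : ℂ => Complex.exp (-(t ^ 2 / 2)))
        (Complex.exp (-(w ^ 2 / 2)) * (-w)) w := by
      have := (((hasDerivAt_id w).pow 2).div_const 2).neg.cexp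
      simpa using this
    refine (h1.mul h2).deriv.trans ?_
    simp only [Polynomial.hermite_succ, map_sub, map_mul, Polynomial.aeval_X]
    ring

/-- Cauchy's estimate on a circle of radius `R` for the entire function `e^{-w²/2}`. The radius is
left free; `R² = n` is the choice that gives the true growth in `n`. -/
theorem abs_hermiteGauss_le (n : ℕ) (t : ℝ) {R : ℝ} (hR : 0 < R) :
    |hermiteGauss n t| ≤ n.factorial * Real.exp (R ^ 2 / 2) / R ^ n * Real.exp (-(t ^ 2 / 4)) := by
  have hd : Differentiable ℂ (fun w : ℂ => Complex.exp (-(w ^ 2 / 2))) := by fun_prop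
  have key := Complex.norm_iteratedDeriv_le_of_forall_mem_sphere_norm_le (c := (t : ℂ)) (R := R)
    (C := Real.exp (R ^ 2 / 2) * Real.exp (-(t ^ 2 / 4))) n hR hd.diffContOnCl (by
      intro z hz
      have hz' : Complex.normSq (z - t) = R ^ 2 := by
        rw [Complex.normSq_eq_norm_sq, mem_sphere_iff_norm.1 hz]
      rw [Complex.normSq_apply] at hz'
      simp only [Complex.sub_re, Complex.sub_im, Complex.ofReal_re, Complex.ofReal_im,
        sub_zero] at hz'
      rw [Complex.norm_exp, ← Real.exp_add]
      refine Real.exp_le_exp.2 ?_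
      have : (-(z ^ 2 / 2)).re = -((z.re * z.re - z.im * z.im) / 2) := by
        rw [pow_two, Complex.neg_re, show z * z / 2 = z * z / ((2 : ℝ) : ℂ) by norm_num,
          Complex.div_ofReal_re, Complex.mul_re]
      rw [this]
      nlinarith [sq_nonneg (2 * z.re - t)])
  rw [iteratedDeriv_complex_gaussian] at key
  have e : (-1 : ℂ) ^ n * Polynomial.aeval (t : ℂ) (Polynomial.hermite n)
      * Complex.exp (-((t : ℂ) ^ 2 / 2)) = (-1) ^ n * ((hermiteGauss n t : ℝ) : ℂ) := by
    have h : Polynomial.aeval (t : ℂ) (Polynomial.hermite n)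
        = ((Polynomial.aeval t (Polynomial.hermite n) : ℝ) : ℂ) := by
      exact Polynomial.aeval_algebraMap_apply ℂ t _
    rw [h]
    simp [hermiteGauss, mul_assoc]
  rw [e, norm_mul, norm_pow, norm_neg, norm_one, one_pow, one_mul, Complex.norm_real,
    Real.norm_eq_abs] at key
  refine key.trans (le_of_eq ?_)
  ring

theorem integrable_exp_neg_sq_div {a : ℝ} (ha : 0 < a) :
    Integrable fun t : ℝ => Real.exp (-(t ^ 2 / a)) := by
  have := integrable_exp_neg_mul_sq (inv_pos.2 ha)
  refine this.congr (Filter.Eventually.of_forall fun t => ?_)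
  simp only
  congr 1
  field_simp

theorem integral_exp_neg_sq_div (a : ℝ) :
    ∫ t : ℝ, Real.exp (-(t ^ 2 / a)) = √(Real.pi * a) := by
  have := integral_gaussian a⁻¹
  rw [div_inv_eq_mul] at this
  rw [← this]
  congr 1
  funext t
  congr 1
  ring

/-- The elementary form `n! ≤ e n (n/e)^n` of Stirling's upper bound. -/
theorem factorial_mul_exp_le (n : ℕ) (hn : 1 ≤ n) :
    (n.factorial : ℝ) * Real.exp n ≤ Real.exp 1 * n * (n : ℝ) ^ n := by
  induction n, hn using Nat.le_induction with
  | base => simp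
  | succ n hn ih =>
    have hn0 : (0 : ℝ) < n := by exact_mod_cast hn
    -- `e ≤ (1 + 1/n)^(n+1)`
    have h1 : Real.exp 1 * (n : ℝ) ^ (n + 1) ≤ ((n : ℝ) + 1) ^ (n + 1) := by
      have h := Real.one_sub_inv_le_log_of_pos (x := ((n : ℝ) + 1) / n) (by positivity)
      have h2 : 1 ≤ (n + 1 : ℕ) * Real.log (((n : ℝ) + 1) / n) := by
        have h3 : (1 : ℝ) - (((n : ℝ) + 1) / n)⁻¹ = 1 / (n + 1) := by field_simp; ring
        rw [h3] at h
        push_cast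
        calc (1 : ℝ) = (n + 1) * (1 / (n + 1)) := by field_simp
          _ ≤ _ := by gcongr
      have h4 := Real.exp_le_exp.2 h2
      rw [Real.exp_nat_mul, Real.exp_log (by positivity), div_pow,
        le_div_iff₀ (by positivity)] at h4
      exact h4
    calc ((n + 1).factorial : ℝ) * Real.exp (n + 1 : ℕ)
        = (n + 1) * Real.exp 1 * (n.factorial * Real.exp n) := by
          rw [Nat.factorial_succ]; push_cast; rw [Real.exp_add]; ring
      _ ≤ (n + 1) * Real.exp 1 * (Real.exp 1 * n * (n : ℝ) ^ n) := by gcongr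
      _ = Real.exp 1 * (n + 1) * (Real.exp 1 * (n : ℝ) ^ (n + 1)) := by ring
      _ ≤ Real.exp 1 * (n + 1) * ((n : ℝ) + 1) ^ (n + 1) := by gcongr
      _ = _ := by push_cast; ring

/-- With the normalization of the HDAF, the even Hermite functions grow only polynomially with the
order. -/
theorem abs_hermiteGauss_even_le (l : ℕ) (t : ℝ) :
    |hermiteGauss (2 * l) t| / (2 ^ l * l.factorial)
      ≤ 2 * Real.exp 1 * (l + 1) * Real.exp (-(t ^ 2 / 4)) := by
  rcases Nat.eq_zero_or_pos l with rfl | hl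
  · have : (1 : ℝ) ≤ 2 * Real.exp 1 := by linarith [Real.add_one_le_exp (1 : ℝ)]
    simp only [mul_zero, hermiteGauss, Polynomial.hermite_zero, map_one, one_mul, pow_zero,
      Nat.factorial_zero, Nat.cast_one, mul_one, div_one, Nat.cast_zero, zero_add,
      abs_of_pos (Real.exp_pos _)]
    refine le_trans ?_ (le_mul_of_one_le_left (Real.exp_pos _).le this)
    exact Real.exp_le_exp.2 (by nlinarith [sq_nonneg t])
  · have hl0 : (0 : ℝ) < l := by exact_mod_cast hl
    have hR : 0 < √(2 * l : ℝ) := by positivity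
    have h := abs_hermiteGauss_le (2 * l) t hR
    rw [pow_mul, Real.sq_sqrt (by positivity)] at h
    have hf := factorial_mul_exp_le (2 * l) (by omega)
    have hg := Real.pow_div_factorial_le_exp (l : ℝ) hl0.le l
    rw [div_le_iff₀ (by positivity)] at hg
    rw [div_le_iff₀ (by positivity)]
    refine h.trans ?_
    rw [mul_right_comm]
    refine mul_le_mul_of_nonneg_right ?_ (Real.exp_pos _).le
    rw [div_le_iff₀ (by positivity)]
    have e1 : Real.exp ((2 * l : ℕ) : ℝ) = Real.exp l * Real.exp l := by
      rw [← Real.exp_add]; push_cast; ring_nf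
    rw [e1] at hf
    have e2 : (2 * (l : ℝ)) / 2 = l := by ring
    rw [e2]
    refine le_of_mul_le_mul_right ?_ (Real.exp_pos (l : ℝ))
    calc ((2 * l).factorial : ℝ) * Real.exp l * Real.exp l
        ≤ Real.exp 1 * ((2 * l : ℕ) : ℝ) * ((2 * l : ℕ) : ℝ) ^ (2 * l) := by linarith [hf]
      _ = 2 * Real.exp 1 * l * 2 ^ l * (2 * l) ^ l * (l : ℝ) ^ l := by
          push_cast
          rw [mul_pow, mul_pow, pow_mul 2, pow_mul (l : ℝ)]
          rw [show (2 ^ 2 : ℝ) = 2 * 2 by norm_num, mul_pow, pow_two (l : ℝ), mul_pow]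
          ring
      _ ≤ 2 * Real.exp 1 * (l + 1) * 2 ^ l * (2 * l) ^ l * (Real.exp l * l.factorial) := by
          gcongr
          linarith
      _ = _ := by ring

theorem integrable_hermiteGauss_mul_pow (n k : ℕ) :
    Integrable fun t : ℝ => hermiteGauss n t * t ^ k := by
  have hb : Integrable fun t : ℝ =>
      n.factorial * Real.exp (1 ^ 2 / 2) / 1 ^ n * (k.factorial * Real.exp 2)
        * Real.exp (-(t ^ 2 / 8)) := (integrable_exp_neg_sq_div (by norm_num)).const_mul _
  refine hb.mono' ((continuous_hermiteGauss n).mul (continuous_pow k)).aestronglyMeasurable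
    (Filter.Eventually.of_forall fun t => ?_)
  rw [norm_mul, norm_pow, Real.norm_eq_abs, Real.norm_eq_abs]
  have h1 := abs_hermiteGauss_le n t one_pos
  have h2 := Real.pow_div_factorial_le_exp |t| (abs_nonneg t) k
  rw [div_le_iff₀ (by positivity)] at h2
  have h3 : Real.exp |t| * Real.exp (-(t ^ 2 / 4)) ≤ Real.exp 2 * Real.exp (-(t ^ 2 / 8)) := by
    rw [← Real.exp_add, ← Real.exp_add]
    refine Real.exp_le_exp.2 ?_
    nlinarith [sq_nonneg (|t| - 4), sq_abs t]
  calc |hermiteGauss n t| * |t| ^ k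
      ≤ (n.factorial * Real.exp (1 ^ 2 / 2) / 1 ^ n * Real.exp (-(t ^ 2 / 4)))
        * (Real.exp |t| * k.factorial) := by gcongr
    _ = n.factorial * Real.exp (1 ^ 2 / 2) / 1 ^ n * k.factorial
        * (Real.exp |t| * Real.exp (-(t ^ 2 / 4))) := by ring
    _ ≤ n.factorial * Real.exp (1 ^ 2 / 2) / 1 ^ n * k.factorial
        * (Real.exp 2 * Real.exp (-(t ^ 2 / 8))) := by gcongr
    _ = _ := by ring

/-- Integration by parts `k` times: derivatives of the Gaussian annihilate polynomials of smaller
degree. -/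
theorem integral_hermiteGauss_mul_pow_eq_zero {n k : ℕ} (hk : k < n) :
    ∫ t : ℝ, hermiteGauss n t * t ^ k = 0 := by
  induction k generalizing n with
  | zero =>
    obtain ⟨n, rfl⟩ : ∃ n', n = n' + 1 := ⟨n - 1, by omega⟩
    have h := integral_eq_zero_of_hasDerivAt_of_integrable (f := hermiteGauss n)
      (hasDerivAt_hermiteGauss n)
      (by simpa using (integrable_hermiteGauss_mul_pow (n + 1) 0).neg)
      (by simpa using integrable_hermiteGauss_mul_pow n 0)
    rw [integral_neg, neg_eq_zero] at h
    simpa using h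
  | succ k ih =>
    obtain ⟨n, rfl⟩ : ∃ n', n = n' + 1 := ⟨n - 1, by omega⟩
    have hd : ∀ t : ℝ, HasDerivAt (fun t => hermiteGauss n t * t ^ (k + 1))
        (-(hermiteGauss (n + 1) t * t ^ (k + 1)) + (k + 1) * (hermiteGauss n t * t ^ k)) t := by
      intro t
      have h2 : HasDerivAt (fun t : ℝ => t ^ (k + 1)) ((k + 1) * t ^ k) t := by
        simpa using hasDerivAt_pow (k + 1) t
      refine ((hasDerivAt_hermiteGauss n t).mul h2).congr_deriv ?_
      ring
    have i1 := integrable_hermiteGauss_mul_pow (n + 1) (k + 1)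
    have i2 := (integrable_hermiteGauss_mul_pow n k).const_mul ((k : ℝ) + 1)
    have h := integral_eq_zero_of_hasDerivAt_of_integrable hd (i1.neg.add i2)
      (integrable_hermiteGauss_mul_pow n (k + 1))
    have e := integral_add i1.neg i2
    simp only [Pi.neg_apply] at e
    rw [e, integral_neg, integral_const_mul, ih (by omega), mul_zero, add_zero, neg_eq_zero] at h
    exact h

theorem norm_cexp_neg_I_mul (w t : ℝ) : ‖Complex.exp (-(Complex.I * w * t))‖ = 1 := by
  rw [show -(Complex.I * w * t) = ((-(w * t) : ℝ) : ℂ) * Complex.I by push_cast; ring,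
    Complex.norm_exp_ofReal_mul_I]

theorem integrable_hermiteGauss_mul_cexp (n : ℕ) (w : ℝ) :
    Integrable fun t : ℝ => (hermiteGauss n t : ℂ) * Complex.exp (-(Complex.I * w * t)) := by
  have h := (integrable_hermiteGauss_mul_pow n 0)
  simp only [pow_zero, mul_one] at h
  refine h.norm.mono' ?_ (Filter.Eventually.of_forall fun t => ?_)
  · refine Continuous.aestronglyMeasurable ?_
    have := continuous_hermiteGauss n
    fun_prop
  · rw [norm_mul, norm_cexp_neg_I_mul, mul_one, Complex.norm_real]

theorem integral_hermiteGauss_mul_cexp (n : ℕ) (w : ℝ) :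
    ∫ t : ℝ, (hermiteGauss n t : ℂ) * Complex.exp (-(Complex.I * w * t))
      = (-(Complex.I * w)) ^ n * (√(2 * Real.pi) * Real.exp (-(w ^ 2 / 2)) : ℝ) := by
  induction n with
  | zero =>
    have h := fourierIntegral_gaussian (b := ((1 / 2 : ℝ) : ℂ)) (by norm_num) (-w)
    rw [pow_zero, one_mul]
    have e : ∀ t : ℝ, (hermiteGauss 0 t : ℂ) * Complex.exp (-(Complex.I * w * t))
        = Complex.exp (Complex.I * (-w) * t) * Complex.exp (-((1 / 2 : ℝ) : ℂ) * t ^ 2) := by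
      intro t
      simp only [hermiteGauss, Polynomial.hermite_zero, map_one, one_mul, Complex.ofReal_exp]
      rw [mul_comm]
      congr 2 <;> push_cast <;> ring
    simp_rw [e]
    rw [h]
    have e2 : ((Real.pi : ℂ) / ((1 / 2 : ℝ) : ℂ)) ^ (1 / 2 : ℂ) = ((√(2 * Real.pi) : ℝ) : ℂ) := by
      rw [Real.sqrt_eq_rpow, Complex.ofReal_cpow (by positivity)]
      push_cast
      congr 1
      ring
    rw [e2]
    push_cast
    congr 2
    ring
  | succ n ih =>
    have hd : ∀ t : ℝ, HasDerivAt
        (fun t : ℝ => (hermiteGauss n t : ℂ) * Complex.exp (-(Complex.I * w * t)))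
        (-((hermiteGauss (n + 1) t : ℂ) * Complex.exp (-(Complex.I * w * t)))
          + (-(Complex.I * w)) * ((hermiteGauss n t : ℂ)
            * Complex.exp (-(Complex.I * w * t)))) t := by
      intro t
      have h2 : HasDerivAt (fun t : ℝ => Complex.exp (-(Complex.I * w * t)))
          (Complex.exp (-(Complex.I * w * t)) * (-(Complex.I * w))) t := by
        have := ((Complex.ofRealCLM.hasDerivAt (x := t)).const_mul (Complex.I * w)).neg.cexp
        simpa using this
      refine ((hasDerivAt_hermiteGauss n t).ofReal_comp.mul h2).congr_deriv ?_
      push_cast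
      ring
    have i1 := integrable_hermiteGauss_mul_cexp (n + 1) w
    have i2 := (integrable_hermiteGauss_mul_cexp n w).const_mul (-(Complex.I * w))
    have h := integral_eq_zero_of_hasDerivAt_of_integrable hd (i1.neg.add i2)
      (integrable_hermiteGauss_mul_cexp n w)
    have e := integral_add i1.neg i2
    simp only [Pi.neg_apply] at e
    rw [e, integral_neg, integral_const_mul, ih] at h
    rw [pow_succ', mul_assoc]
    linear_combination -h

/-- The kernel `Φ_p(t) = e^{-t²/2} ∑_{l ≤ p} (-1)^l / (2^l l!) He_{2l}(t)`, which is the HDAF of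
order `p` at unit localization. -/
def hermiteKernel (p : ℕ) (t : ℝ) : ℝ :=
  ∑ l ∈ Finset.range (p + 1), (-1) ^ l / (2 ^ l * (l.factorial : ℝ)) * hermiteGauss (2 * l) t

theorem hdaf_eq_hermiteKernel (p : ℕ) (γ x : ℝ) :
    hdaf p γ x = 1 / γ * hermiteKernel p (x / γ) := by
  have h2 : √2 ≠ 0 := by positivity
  have e1 : √2 * (x / (√2 * γ)) = x / γ := by
    rcases eq_or_ne γ 0 with rfl | h
    · simp
    · field_simp
  have e2 : -(x / (√2 * γ)) ^ 2 = -((x / γ) ^ 2 / 2) := by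
    rw [div_pow, mul_pow, Real.sq_sqrt (by norm_num), div_pow, div_div]
    ring
  unfold hdaf hermiteKernel physHermite hermiteGauss
  rw [e2, e1, mul_assoc, Finset.mul_sum]
  congr 1
  refine Finset.sum_congr rfl fun l _ => ?_
  have e3 : (√2) ^ (2 * l) = 2 ^ l := by rw [pow_mul, Real.sq_sqrt (by norm_num)]
  have e4 : (4 : ℝ) ^ l = 2 ^ l * 2 ^ l := by rw [← mul_pow]; norm_num
  rw [e3, e4]
  field_simp

theorem continuous_hermiteKernel (p : ℕ) : Continuous (hermiteKernel p) := by
  unfold hermiteKernel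
  exact continuous_finsetSum _ fun l _ => (continuous_hermiteGauss _).const_mul _

theorem abs_hermiteKernel_le (p : ℕ) (t : ℝ) :
    |hermiteKernel p t| ≤ 2 * Real.exp 1 * ((p : ℝ) + 1) ^ 2 * Real.exp (-(t ^ 2 / 4)) := by
  unfold hermiteKernel
  refine (Finset.abs_sum_le_sum_abs _ _).trans ?_
  have h : ∀ l ∈ Finset.range (p + 1),
      |(-1) ^ l / (2 ^ l * (l.factorial : ℝ)) * hermiteGauss (2 * l) t|
        ≤ 2 * Real.exp 1 * ((p : ℝ) + 1) * Real.exp (-(t ^ 2 / 4)) := by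
    intro l hl
    have hl' : (l : ℝ) ≤ p := by
      exact_mod_cast Nat.lt_succ_iff.1 (Finset.mem_range.1 hl)
    rw [abs_mul, abs_div, abs_pow, abs_neg, abs_one, one_pow,
      abs_of_pos (by positivity : (0 : ℝ) < 2 ^ l * (l.factorial : ℝ)), one_div_mul_eq_div]
    refine (abs_hermiteGauss_even_le l t).trans ?_
    gcongr
  refine (Finset.sum_le_card_nsmul _ _ _ h).trans (le_of_eq ?_)
  rw [Finset.card_range, nsmul_eq_mul]
  push_cast
  ring

/-- A Christoffel–Darboux identity: `t Φ_p(t)` is a single Hermite function. -/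
theorem mul_hermiteKernel (p : ℕ) (t : ℝ) :
    t * hermiteKernel p t
      = (-1) ^ p / (2 ^ p * (p.factorial : ℝ)) * hermiteGauss (2 * p + 1) t := by
  induction p with
  | zero => simp [hermiteKernel, hermiteGauss]
  | succ p ih =>
    have e : hermiteKernel (p + 1) t = hermiteKernel p t
        + (-1) ^ (p + 1) / (2 ^ (p + 1) * ((p + 1).factorial : ℝ))
          * hermiteGauss (2 * (p + 1)) t := by
      unfold hermiteKernel
      rw [Finset.sum_range_succ]
    have r := hermiteGauss_recurrence (2 * p + 1) t
    have f : ((p + 1).factorial : ℝ) = (p + 1) * p.factorial := by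
      rw [Nat.factorial_succ]; push_cast; ring
    have hp : (p.factorial : ℝ) ≠ 0 := by positivity
    have hp1 : (p : ℝ) + 1 ≠ 0 := by positivity
    rw [e, mul_add, ih, show 2 * (p + 1) + 1 = 2 * p + 1 + 2 by ring, r,
      show 2 * (p + 1) = 2 * p + 1 + 1 by ring, f]
    push_cast
    field_simp
    ring

theorem integrable_hermiteKernel_mul_pow (p k : ℕ) :
    Integrable fun t : ℝ => hermiteKernel p t * t ^ k := by
  unfold hermiteKernel
  simp only [Finset.sum_mul, mul_assoc]
  exact integrable_finsetSum _ fun l _ =>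
    (integrable_hermiteGauss_mul_pow (2 * l) k).const_mul _

theorem integrable_hermiteKernel (p : ℕ) : Integrable (hermiteKernel p) := by
  simpa using integrable_hermiteKernel_mul_pow p 0

theorem integral_hermiteKernel_mul_pow {p k : ℕ} (hk : k ≤ 2 * p) :
    ∫ t : ℝ, hermiteKernel p t * t ^ (k + 1) = 0 := by
  have e : ∀ t : ℝ, hermiteKernel p t * t ^ (k + 1)
      = (-1) ^ p / (2 ^ p * (p.factorial : ℝ)) * (hermiteGauss (2 * p + 1) t * t ^ k) := by
    intro t
    rw [← mul_assoc, ← mul_hermiteKernel, pow_succ]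
    ring
  simp_rw [e]
  rw [integral_const_mul, integral_hermiteGauss_mul_pow_eq_zero (by omega), mul_zero]

/-- The HDAF filter `σ_p(w) = e^{-w²/2} ∑_{l ≤ p} w^{2l} / (2^l l!)`. -/
def hdafFilter (p : ℕ) (w : ℝ) : ℝ :=
  Real.exp (-(w ^ 2 / 2)) * ∑ l ∈ Finset.range (p + 1), (w ^ 2 / 2) ^ l / (l.factorial : ℝ)

theorem integral_hermiteKernel_mul_cexp (p : ℕ) (w : ℝ) :
    ∫ t : ℝ, (hermiteKernel p t : ℂ) * Complex.exp (-(Complex.I * w * t))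
      = (√(2 * Real.pi) * hdafFilter p w : ℝ) := by
  have e : ∀ t : ℝ, (hermiteKernel p t : ℂ) * Complex.exp (-(Complex.I * w * t))
      = ∑ l ∈ Finset.range (p + 1), (((-1) ^ l / (2 ^ l * (l.factorial : ℝ)) : ℝ) : ℂ)
          * ((hermiteGauss (2 * l) t : ℂ) * Complex.exp (-(Complex.I * w * t))) := by
    intro t
    unfold hermiteKernel
    rw [Complex.ofReal_sum, Finset.sum_mul]
    refine Finset.sum_congr rfl fun l _ => ?_
    rw [Complex.ofReal_mul]
    ring
  simp_rw [e]
  rw [integral_finsetSum _ fun l _ => (integrable_hermiteGauss_mul_cexp (2 * l) w).const_mul _]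
  unfold hdafFilter
  rw [← mul_assoc, Finset.mul_sum, Complex.ofReal_sum]
  refine Finset.sum_congr rfl fun l _ => ?_
  rw [integral_const_mul, integral_hermiteGauss_mul_cexp, pow_mul]
  have : (-(Complex.I * (w : ℂ))) ^ 2 = ((-(w ^ 2) : ℝ) : ℂ) := by
    rw [neg_sq, mul_pow, Complex.I_sq]; push_cast; ring
  rw [this, ← Complex.ofReal_pow, ← Complex.ofReal_mul, ← Complex.ofReal_mul]
  congr 1
  rw [neg_pow, div_pow]
  have h1 : ((-1 : ℝ) ^ l) * (-1) ^ l = 1 := by rw [← mul_pow]; norm_num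
  field_simp
  linear_combination (w ^ 2) ^ l * h1

theorem integral_hermiteKernel (p : ℕ) : ∫ t : ℝ, hermiteKernel p t = √(2 * Real.pi) := by
  have h := integral_hermiteKernel_mul_cexp p 0
  simp only [Complex.ofReal_zero, mul_zero, zero_mul, neg_zero, Complex.exp_zero, mul_one] at h
  rw [integral_complex_ofReal] at h
  have h' := Complex.ofReal_injective h
  rw [h']
  unfold hdafFilter
  rw [Finset.sum_range_succ']
  simp

/-! ### Uniform Taylor expansions of analytic functions -/

/-- `g` has a Taylor expansion at `x` with geometric bounds: coefficients at most `M / r ^ k`, and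
the corresponding remainder estimate on the half-radius ball. -/
def HasGeometricTaylor (g : ℝ → ℝ) (M r x : ℝ) : Prop :=
  ∃ c : ℕ → ℝ, c 0 = g x ∧ (∀ k, |c k| ≤ M / r ^ k) ∧
    ∀ y, |y - x| ≤ r / 2 → ∀ K : ℕ,
      |g y - ∑ k ∈ Finset.range K, c k * (y - x) ^ k| ≤ 2 * M * (|y - x| / r) ^ K

theorem HasGeometricTaylor.mono {g : ℝ → ℝ} {M r x M' r' : ℝ} (h : HasGeometricTaylor g M r x)
    (hM : M ≤ M') (hr' : 0 < r') (hr : r' ≤ r) (hM0 : 0 ≤ M) : HasGeometricTaylor g M' r' x := by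
  obtain ⟨c, h0, hc, hy⟩ := h
  have hr0 := hr'.trans_le hr
  refine ⟨c, h0, fun k => (hc k).trans ?_, fun y hyx K => (hy y (by linarith) K).trans ?_⟩
  · have := hM0.trans hM
    gcongr
  · have := hM0.trans hM
    gcongr

/-- If coefficients decay geometrically, the tail of the power series is controlled by its first
omitted power. -/
theorem hasGeometricTaylor_of_hasSum {g : ℝ → ℝ} {M r x : ℝ} (hM : 0 ≤ M) (hr : 0 < r)
    {c : ℕ → ℝ} (hc : ∀ k, |c k| ≤ M / r ^ k)
    (hs : ∀ z : ℝ, |z| < r → HasSum (fun k => c k * z ^ k) (g (x + z))) :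
    HasGeometricTaylor g M r x := by
  refine ⟨c, ?_, hc, fun y hy K => ?_⟩
  · have h := hs 0 (by simpa using hr)
    have h' : HasSum (fun k => c k * (0 : ℝ) ^ k) (c 0 * 0 ^ 0) :=
      hasSum_single 0 fun k hk => by simp [hk]
    simpa using h'.unique h
  · have h := hs (y - x) (by linarith)
    rw [add_sub_cancel] at h
    have h1 := (hasSum_nat_add_iff' K).2 h
    set q := |y - x| / r with hq
    have hq0 : 0 ≤ q := by positivity
    have hq1 : q ≤ 1 / 2 := by rw [hq, div_le_iff₀ hr]; linarith
    have hg : HasSum (fun k : ℕ => M * q ^ K * (1 / 2 : ℝ) ^ k) (M * q ^ K * 2) :=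
      hasSum_geometric_two.mul_left _
    have hb : ∀ k, ‖c (k + K) * (y - x) ^ (k + K)‖ ≤ M * q ^ K * (1 / 2 : ℝ) ^ k := by
      intro k
      rw [norm_mul, norm_pow, Real.norm_eq_abs, Real.norm_eq_abs]
      calc |c (k + K)| * |y - x| ^ (k + K) ≤ M / r ^ (k + K) * |y - x| ^ (k + K) := by
            gcongr; exact hc _
        _ = M * q ^ K * q ^ k := by rw [hq, div_pow, div_pow, pow_add, pow_add]; field_simp
        _ ≤ _ := by gcongr
    have := tsum_of_norm_bounded hg hb
    rw [h1.tsum_eq, Real.norm_eq_abs] at this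
    linarith

/-- Near a point of analyticity all Taylor expansions have common geometric bounds: the power series
extends to a bounded holomorphic function on a complex disc, and Cauchy's estimates apply on
smaller discs with nearby centres. -/
theorem exists_hasGeometricTaylor_of_analyticAt {g : ℝ → ℝ} {a : ℝ} (hg : AnalyticAt ℝ g a) :
    ∃ M r : ℝ, 0 < M ∧ 0 < r ∧ ∀ x, |x - a| < r → HasGeometricTaylor g M r x := by
  obtain ⟨p, hp⟩ := hg
  rw [hasFPowerSeriesAt_iff] at hp
  obtain ⟨ε, hε, hsum⟩ := Metric.eventually_nhds_iff.1 hp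
  set ρ := ε / 2 with hρdef
  have hρ : 0 < ρ := by positivity
  have hs0 := hsum (y := ρ) (by rw [Real.dist_eq, sub_zero, abs_of_pos hρ]; linarith)
  obtain ⟨C, hC⟩ := (Metric.isBounded_range_of_tendsto _
    hs0.summable.tendsto_atTop_zero).exists_norm_le
  have hCn : ∀ n, |p.coeff n| ≤ C / ρ ^ n := by
    intro n
    have := hC _ ⟨n, rfl⟩
    simp only [smul_eq_mul, norm_mul, norm_pow, Real.norm_eq_abs, abs_of_pos hρ] at this
    rw [le_div_iff₀ (by positivity)]
    linarith
  have hC0 : 0 ≤ C := (abs_nonneg _).trans (by simpa using hCn 0)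
  set R := 3 * ρ / 4 with hR
  let G : ℂ → ℂ := fun w => ∑' n : ℕ, (p.coeff n : ℂ) * w ^ n
  have hbound : ∀ (n : ℕ) (w : ℂ), w ∈ Metric.ball (0 : ℂ) R →
      ‖(p.coeff n : ℂ) * w ^ n‖ ≤ C * (3 / 4 : ℝ) ^ n := by
    intro n w hw
    rw [mem_ball_zero_iff] at hw
    rw [norm_mul, norm_pow, Complex.norm_real, Real.norm_eq_abs]
    calc |p.coeff n| * ‖w‖ ^ n ≤ C / ρ ^ n * R ^ n := by
          gcongr
          exact hCn n
      _ = C * (3 / 4 : ℝ) ^ n := by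
          rw [hR, show 3 * ρ / 4 = 3 / 4 * ρ by ring, mul_pow]; field_simp
  have hgeo : HasSum (fun n : ℕ => C * (3 / 4 : ℝ) ^ n) (C * 4) := by
    have := (hasSum_geometric_of_lt_one (r := (3 / 4 : ℝ)) (by norm_num) (by norm_num)).mul_left C
    rwa [show (1 - 3 / 4 : ℝ)⁻¹ = 4 by norm_num] at this
  have hGsum : ∀ w ∈ Metric.ball (0 : ℂ) R, HasSum (fun n : ℕ => (p.coeff n : ℂ) * w ^ n) (G w) :=
    fun w hw => (Summable.of_norm_bounded hgeo.summable fun n => hbound n w hw).hasSum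
  have hGd : DifferentiableOn ℂ G (Metric.ball 0 R) :=
    Complex.differentiableOn_tsum_of_summable_norm hgeo.summable
      (fun n => ((differentiable_id.pow n).const_mul _).differentiableOn) Metric.isOpen_ball hbound
  have hGb : ∀ w ∈ Metric.ball (0 : ℂ) R, ‖G w‖ ≤ C * 4 := fun w hw =>
    tsum_of_norm_bounded hgeo fun n => hbound n w hw
  have hGre : ∀ z : ℝ, |z| < R → (G z).re = g (a + z) := by
    intro z hz
    have h1 := Complex.hasSum_re (hGsum z (by
      rw [mem_ball_zero_iff, Complex.norm_real, Real.norm_eq_abs]; exact hz))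
    have h2 := hsum (y := z) (by rw [Real.dist_eq, sub_zero]; linarith)
    have e : (fun n : ℕ => ((p.coeff n : ℂ) * (z : ℂ) ^ n).re) = fun n => z ^ n • p.coeff n := by
      funext n
      rw [← Complex.ofReal_pow, ← Complex.ofReal_mul, Complex.ofReal_re, smul_eq_mul, mul_comm]
    rw [e] at h1
    exact h1.unique h2
  have hr : 0 < ρ / 4 := by positivity
  refine ⟨C * 4 + 1, ρ / 4, by positivity, hr, fun x hx => ?_⟩
  set u := x - a with hu
  have hsub : Metric.closedBall (u : ℂ) (ρ / 4) ⊆ Metric.ball 0 R := by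
    intro w hw
    rw [mem_closedBall_iff_norm] at hw
    rw [mem_ball_zero_iff]
    calc ‖w‖ = ‖(w - u) + u‖ := by rw [sub_add_cancel]
      _ ≤ ‖w - u‖ + ‖(u : ℂ)‖ := norm_add_le _ _
      _ = ‖w - u‖ + |u| := by rw [Complex.norm_real, Real.norm_eq_abs]
      _ < R := by rw [hR]; linarith
  let r' : NNReal := ⟨ρ / 4, hr.le⟩
  have hps := (hGd.mono hsub).hasFPowerSeriesOnBall (R := r') hr
  set P := cauchyPowerSeries G (u : ℂ) r'
  have hcoef : ∀ k, ‖P.coeff k‖ ≤ C * 4 / (ρ / 4) ^ k := by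
    intro k
    have h1 := norm_cauchyPowerSeries_le G (u : ℂ) r' k
    have h2 : (∫ θ : ℝ in 0..2 * Real.pi, ‖G (circleMap u r' θ)‖) ≤ C * 4 * (2 * Real.pi) := by
      have := intervalIntegral.norm_integral_le_of_norm_le_const (a := 0) (b := 2 * Real.pi)
        (f := fun θ => ‖G (circleMap u r' θ)‖) (C := C * 4) (fun θ _ => by
          rw [norm_norm]
          exact hGb _ (hsub (circleMap_mem_closedBall _ hr.le _)))
      rw [sub_zero, abs_of_pos Real.two_pi_pos] at this
      exact (le_abs_self _).trans this
    rw [FormalMultilinearSeries.norm_apply_eq_norm_coef] at h1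
    refine h1.trans ?_
    have h3 : |(r' : ℝ)| = ρ / 4 := abs_of_pos hr
    rw [h3, inv_pow, ← div_eq_mul_inv]
    refine div_le_div_of_nonneg_right ?_ (by positivity)
    rw [inv_mul_le_iff₀ Real.two_pi_pos]
    linarith
  refine hasGeometricTaylor_of_hasSum (c := fun k => (P.coeff k).re) (by positivity) hr
    (fun k => (Complex.abs_re_le_norm _).trans ((hcoef k).trans ?_)) fun z hz => ?_
  · gcongr
    linarith
  · have h1 := hps.hasSum (y := (z : ℂ)) (by
      rw [Metric.mem_eball, edist_zero_right, ← ofReal_norm, Complex.norm_real,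
        Real.norm_eq_abs, ENNReal.ofReal_lt_coe_iff (abs_nonneg _)]
      exact hz)
    have h2 := Complex.hasSum_re h1
    have e : x + z = a + (u + z) := by rw [hu]; ring
    rw [e, ← hGre (u + z) (by
      calc |u + z| ≤ |u| + |z| := abs_add_le _ _
        _ < R := by rw [hR]; linarith)]
    push_cast
    have e2 : (fun k : ℕ => (P.coeff k).re * z ^ k) = fun k => (P k fun _ => (z : ℂ)).re := by
      funext k
      rw [FormalMultilinearSeries.apply_eq_pow_smul_coeff, smul_eq_mul, ← Complex.ofReal_pow,
        Complex.re_ofReal_mul, mul_comm]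
    rw [e2]
    exact h2

theorem exists_hasGeometricTaylor_of_analyticOnNhd {g : ℝ → ℝ} {s : Set ℝ} (hs : IsCompact s)
    (hg : AnalyticOnNhd ℝ g s) :
    ∃ M r : ℝ, 0 < M ∧ 0 < r ∧ ∀ x ∈ s, HasGeometricTaylor g M r x := by
  refine hs.induction_on (p := fun t => ∃ M r : ℝ, 0 < M ∧ 0 < r ∧ ∀ x ∈ t,
    HasGeometricTaylor g M r x) ⟨1, 1, one_pos, one_pos, fun x hx => hx.elim⟩ ?_ ?_ ?_
  · rintro t t' htt' ⟨M, r, hM, hr, h⟩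
    exact ⟨M, r, hM, hr, fun x hx => h x (htt' hx)⟩
  · rintro t t' ⟨M, r, hM, hr, h⟩ ⟨M', r', hM', hr', h'⟩
    refine ⟨max M M', min r r', lt_max_of_lt_left hM, lt_min hr hr', ?_⟩
    rintro x (hx | hx)
    · exact (h x hx).mono (le_max_left _ _) (lt_min hr hr') (min_le_left _ _) hM.le
    · exact (h' x hx).mono (le_max_right _ _) (lt_min hr hr') (min_le_right _ _) hM'.le
  · intro x hx
    obtain ⟨M, r, hM, hr, h⟩ := exists_hasGeometricTaylor_of_analyticAt (hg x hx)
    exact ⟨Metric.ball x r, mem_nhdsWithin_of_mem_nhds (Metric.ball_mem_nhds x hr), M, r, hM, hr,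
      fun y hy => h y (by simpa [Real.dist_eq] using hy)⟩

/-! ### Mollification as an integral over the line -/

/-- The `1`-periodic function that agrees with `g` on `[ξ, ξ + 1)`. -/
def periodicExt (g : ℝ → ℝ) (ξ y : ℝ) : ℝ := g (ξ + Int.fract (y - ξ))

theorem add_fract_mem_Icc (ξ y : ℝ) : ξ + Int.fract y ∈ Set.Icc ξ (ξ + 1) :=
  ⟨by linarith [Int.fract_nonneg y], by linarith [Int.fract_lt_one y]⟩

theorem measurable_periodicExt {g : ℝ → ℝ} {ξ : ℝ} (hg : ContinuousOn g (Set.Icc ξ (ξ + 1))) :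
    Measurable (periodicExt g ξ) := by
  have hle : ξ ≤ ξ + 1 := by linarith
  have hc : Continuous (Set.IccExtend hle ((Set.Icc ξ (ξ + 1)).domRestrict g)) :=
    (continuousOn_iff_continuous_domRestrict.1 hg).Icc_extend'
  have e : periodicExt g ξ
      = fun y => Set.IccExtend hle ((Set.Icc ξ (ξ + 1)).domRestrict g) (ξ + Int.fract (y - ξ)) := by
    funext y
    rw [Set.IccExtend_of_mem _ _ (add_fract_mem_Icc ξ _)]
    rfl
  rw [e]
  exact hc.measurable.comp ((measurable_fract.comp (measurable_id.sub_const ξ)).const_add ξ)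

theorem periodicExt_add_int (g : ℝ → ℝ) (ξ y : ℝ) (n : ℤ) :
    periodicExt g ξ (y + n) = periodicExt g ξ y := by
  unfold periodicExt
  rw [show y + n - ξ = (y - ξ) + n by ring, Int.fract_add_intCast]

theorem periodicExt_eq_of_mem {g : ℝ → ℝ} {ξ y : ℝ} (hy : y ∈ Set.Ico ξ (ξ + 1)) :
    periodicExt g ξ y = g y := by
  unfold periodicExt
  rw [Int.fract_eq_self.2 ⟨by linarith [hy.1], by linarith [hy.2]⟩]
  congr 1
  ring

theorem eq_periodicExt {f g : ℝ → ℝ} {ξ : ℝ} (hξ : ξ ∈ Set.Ioo (0 : ℝ) 1)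
    (h1 : ∀ x ∈ Set.Ioc ξ 1, f x = g x) (h2 : ∀ x ∈ Set.Ico 0 ξ, f x = g (x + 1))
    {x : ℝ} (hx : x ∈ Set.Icc (0 : ℝ) 1) (hne : x ≠ ξ) : f x = periodicExt g ξ x := by
  rcases lt_or_gt_of_ne hne with h | h
  · rw [h2 x ⟨hx.1, h⟩]
    have := periodicExt_add_int g ξ x 1
    rw [← this, Int.cast_one,
      periodicExt_eq_of_mem ⟨by linarith [hx.1, hξ.2], by linarith⟩]
  · rw [h1 x ⟨h, hx.2⟩, periodicExt_eq_of_mem ⟨h.le, by linarith [hx.2, hξ.1]⟩]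

theorem integral_tsum_comp_add_int {G : ℝ → ℝ} (hG : Integrable G) :
    ∫ y in (0 : ℝ)..1, ∑' n : ℤ, G (y + n) = ∫ y, G y := by
  have h1 := hG.hasSum_intervalIntegral_comp_add_int
  have h2 := hG.norm.hasSum_intervalIntegral_comp_add_int
  simp only [intervalIntegral.integral_of_le zero_le_one] at h1 h2 ⊢
  rw [← h1.tsum_eq]
  exact ((hasSum_integral_of_summable_integral_norm (F := fun (n : ℤ) y => G (y + n))
    (fun n => (hG.comp_add_right (n : ℝ)).restrict) h2.summable).tsum_eq).symm

/-- The mollifier is the periodization of a rescaled `hermiteKernel`. -/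
theorem mollifier_eq_tsum (m p : ℕ) (γ y : ℝ) :
    mollifier m p γ y = ∑' k : ℤ, √(2 * Real.pi) * m / γ
      * hermiteKernel p (2 * Real.pi * m / γ * (y + k)) := by
  unfold mollifier
  rw [← tsum_mul_left]
  refine tsum_congr fun k => ?_
  rw [hdaf_eq_hermiteKernel]
  rw [show 2 * Real.pi * m * (y + k) / γ = 2 * Real.pi * m / γ * (y + k) by ring]
  ring

theorem integrable_bdd_mul_hermiteKernel {F : ℝ → ℝ} (hF : Measurable F) {M : ℝ}
    (hM : ∀ y, |F y| ≤ M) (p : ℕ) : Integrable fun t => hermiteKernel p t * F t :=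
  (integrable_hermiteKernel p).mul_bdd hF.aestronglyMeasurable
    (Filter.Eventually.of_forall hM)

theorem intervalIntegral_mollifier_mul {f F : ℝ → ℝ} {ξ : ℝ} (hF : Measurable F) {M : ℝ}
    (hM : ∀ y, |F y| ≤ M) (hper : ∀ y (n : ℤ), F (y + n) = F y)
    (hfF : ∀ y ∈ Set.Icc (0 : ℝ) 1, y ≠ ξ → f y = F y) {m : ℕ} (hm : 1 ≤ m) (p : ℕ) {γ : ℝ}
    (hγ : 0 < γ) (x : ℝ) :
    ∫ y in (0 : ℝ)..1, mollifier m p γ (x - y) * f y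
      = 1 / √(2 * Real.pi) * ∫ t, hermiteKernel p t * F (x - γ / (2 * Real.pi * m) * t) := by
  have hm0 : (0 : ℝ) < m := by exact_mod_cast hm
  set s := γ / (2 * Real.pi * m) with hs
  have hs0 : 0 < s := by positivity
  set c := √(2 * Real.pi) * m / γ with hc
  set G : ℝ → ℝ := fun y => c * (hermiteKernel p ((x - y) / s) * F y) with hG
  have hsc : c * s = 1 / √(2 * Real.pi) := by
    have h : √(2 * Real.pi) * √(2 * Real.pi) = 2 * Real.pi :=
      Real.mul_self_sqrt (by positivity)
    rw [hc, hs]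
    field_simp
    rw [pow_two, h]
  have hGint : Integrable G := by
    have h0 := integrable_bdd_mul_hermiteKernel (F := fun t => F (x - s * t)) (by fun_prop)
      (fun y => hM _) p
    have h1 := (((h0.comp_div hs0.ne').comp_sub_left x)).const_mul c
    refine h1.congr (Filter.Eventually.of_forall fun y => ?_)
    simp only [hG]
    rw [mul_div_cancel₀ _ hs0.ne', sub_sub_cancel]
  have e1 : ∫ y in (0 : ℝ)..1, mollifier m p γ (x - y) * f y
      = ∫ y in (0 : ℝ)..1, ∑' n : ℤ, G (y + n) := by
    refine intervalIntegral.integral_congr_ae ?_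
    filter_upwards [compl_mem_ae_iff.2 (measure_singleton ξ)] with y hy hy1
    rw [Set.uIoc_of_le zero_le_one] at hy1
    rw [hfF y ⟨hy1.1.le, hy1.2⟩ hy, mollifier_eq_tsum, ← tsum_mul_right,
      ← (Equiv.neg ℤ).tsum_eq]
    refine tsum_congr fun n => ?_
    simp only [hG, hper, Equiv.neg_apply]
    rw [mul_assoc]
    congr 3
    rw [hs]
    push_cast
    field_simp
    ring
  rw [e1, integral_tsum_comp_add_int hGint, ← integral_sub_left_eq_self G volume x]
  simp only [hG, sub_sub_cancel]
  rw [integral_const_mul]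
  have h2 := Measure.integral_comp_mul_left
    (fun z => hermiteKernel p (z / s) * F (x - z)) s
  simp only [mul_div_cancel_left₀ _ hs0.ne'] at h2
  rw [h2, ← hsc, abs_of_pos (inv_pos.2 hs0), smul_eq_mul]
  field_simp

/-! ### The approximation error of the mollification -/

theorem one_div_sqrt_mul_integral_exp (a : ℝ) :
    1 / √(2 * Real.pi) * ∫ t : ℝ, Real.exp (-(t ^ 2 / (2 * a))) = √a := by
  rw [integral_exp_neg_sq_div, show Real.pi * (2 * a) = 2 * Real.pi * a by ring,
    Real.sqrt_mul (by positivity : 0 ≤ 2 * Real.pi) a]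
  field_simp

/-- The order-free bound, from the `L¹` norm of the kernel. -/
theorem abs_hermiteKernel_average_le {F : ℝ → ℝ} {M : ℝ} (hM : ∀ y, |F y| ≤ M) (p : ℕ) :
    |1 / √(2 * Real.pi) * ∫ t, hermiteKernel p t * F t|
      ≤ 4 * Real.exp 1 * ((p : ℝ) + 1) ^ 2 * M := by
  have hM0 : 0 ≤ M := (abs_nonneg _).trans (hM 0)
  have hb : ∀ t, ‖hermiteKernel p t * F t‖
      ≤ 2 * Real.exp 1 * ((p : ℝ) + 1) ^ 2 * M * Real.exp (-(t ^ 2 / (2 * 2))) := by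
    intro t
    rw [norm_mul, Real.norm_eq_abs, Real.norm_eq_abs]
    have := abs_hermiteKernel_le p t
    calc |hermiteKernel p t| * |F t|
        ≤ (2 * Real.exp 1 * ((p : ℝ) + 1) ^ 2 * Real.exp (-(t ^ 2 / 4))) * M := by
          gcongr
          exact hM t
      _ = _ := by norm_num; ring
  have h := norm_integral_le_of_norm_le
    ((integrable_exp_neg_sq_div (by norm_num : (0 : ℝ) < 2 * 2)).const_mul _)
    (Filter.Eventually.of_forall hb)
  rw [integral_const_mul, Real.norm_eq_abs] at h
  rw [abs_mul, abs_of_pos (by positivity : 0 < 1 / √(2 * Real.pi))]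
  have h2 : √2 ≤ 2 := by rw [Real.sqrt_le_left (by norm_num)]; norm_num
  calc 1 / √(2 * Real.pi) * |∫ t, hermiteKernel p t * F t|
      ≤ 1 / √(2 * Real.pi) * (2 * Real.exp 1 * ((p : ℝ) + 1) ^ 2 * M
          * ∫ t : ℝ, Real.exp (-(t ^ 2 / (2 * 2)))) := by gcongr
    _ = 2 * Real.exp 1 * ((p : ℝ) + 1) ^ 2 * M * (1 / √(2 * Real.pi)
          * ∫ t : ℝ, Real.exp (-(t ^ 2 / (2 * 2)))) := by ring
    _ = 2 * Real.exp 1 * ((p : ℝ) + 1) ^ 2 * M * √2 := by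
        rw [one_div_sqrt_mul_integral_exp 2]
    _ ≤ 2 * Real.exp 1 * ((p : ℝ) + 1) ^ 2 * M * 2 := by gcongr
    _ = _ := by ring

/-- Averages against the kernel reproduce polynomials of degree at most `2p + 1`. -/
theorem hermiteKernel_average_poly {p N : ℕ} (hN : 1 ≤ N) (hNp : N ≤ p + 1) (c : ℕ → ℝ) :
    1 / √(2 * Real.pi) * ∫ t, hermiteKernel p t * ∑ k ∈ Finset.range (2 * N), c k * t ^ k
      = c 0 := by
  have e : ∀ t : ℝ, hermiteKernel p t * ∑ k ∈ Finset.range (2 * N), c k * t ^ k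
      = ∑ k ∈ Finset.range (2 * N), c k * (hermiteKernel p t * t ^ k) := by
    intro t
    rw [Finset.mul_sum]
    exact Finset.sum_congr rfl fun k _ => by ring
  simp_rw [e]
  rw [integral_finsetSum _ fun k _ => (integrable_hermiteKernel_mul_pow p k).const_mul _,
    Finset.sum_eq_single 0]
  · simp only [pow_zero, mul_one]
    rw [integral_const_mul, integral_hermiteKernel]
    field_simp
  · intro k hk hk0
    obtain ⟨k, rfl⟩ : ∃ k', k = k' + 1 := ⟨k - 1, by omega⟩
    rw [integral_const_mul, integral_hermiteKernel_mul_pow, mul_zero]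
    have := Finset.mem_range.1 hk
    omega
  · intro h
    exact (h (Finset.mem_range.2 (by omega))).elim

/-- If `F(x - ·)` is within `D (z²/b²)^N` of a polynomial of degree less than `2N ≤ 2p + 2`, the
average at scale `s` recovers the value at `x` up to `(8 N s² / b²)^N`. -/
theorem abs_sub_hermiteKernel_average_le {F : ℝ → ℝ} (hF : Measurable F) {M : ℝ}
    (hM : ∀ y, |F y| ≤ M) {x b s D : ℝ} (hb : 0 < b) {p N : ℕ} (hN : 1 ≤ N)
    (hNp : N ≤ p + 1) {c : ℕ → ℝ} (hc : c 0 = F x)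
    (hE : ∀ z, |∑ k ∈ Finset.range (2 * N), c k * z ^ k - F (x - z)| ≤ D * (z ^ 2 / b ^ 2) ^ N) :
    |F x - 1 / √(2 * Real.pi) * ∫ t, hermiteKernel p t * F (x - s * t)|
      ≤ 4 * Real.exp 1 * ((p : ℝ) + 1) ^ 2 * D * (8 * N * s ^ 2 / b ^ 2) ^ N := by
  have hD : 0 ≤ D := by
    have := (abs_nonneg _).trans (hE b)
    rwa [div_self (by positivity), one_pow, mul_one] at this
  have h1 := hermiteKernel_average_poly hN hNp (fun k => c k * s ^ k)
  simp only [pow_zero, mul_one] at h1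
  have i1 : Integrable fun t => hermiteKernel p t
      * ∑ k ∈ Finset.range (2 * N), c k * s ^ k * t ^ k := by
    simp only [Finset.mul_sum]
    refine integrable_finsetSum _ fun k _ => ?_
    refine ((integrable_hermiteKernel_mul_pow p k).const_mul (c k * s ^ k)).congr
      (Filter.Eventually.of_forall fun t => ?_)
    simp only
    ring
  have i2 : Integrable fun t => hermiteKernel p t * F (x - s * t) :=
    integrable_bdd_mul_hermiteKernel (F := fun t => F (x - s * t)) (by fun_prop) (fun y => hM _) p
  rw [← hc, ← h1, ← mul_sub, ← integral_sub i1 i2]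
  set A := 2 * Real.exp 1 * ((p : ℝ) + 1) ^ 2 * D * (8 * N * s ^ 2 / b ^ 2) ^ N with hA
  have hbd : ∀ t, ‖hermiteKernel p t * ∑ k ∈ Finset.range (2 * N), c k * s ^ k * t ^ k
      - hermiteKernel p t * F (x - s * t)‖ ≤ A * Real.exp (-(t ^ 2 / (2 * 4))) := by
    intro t
    rw [← mul_sub, norm_mul, Real.norm_eq_abs, Real.norm_eq_abs]
    have h2 := hE (s * t)
    have e : ∑ k ∈ Finset.range (2 * N), c k * (s * t) ^ k
        = ∑ k ∈ Finset.range (2 * N), c k * s ^ k * t ^ k :=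
      Finset.sum_congr rfl fun k _ => by rw [mul_pow, mul_assoc]
    rw [e] at h2
    have h3 : (t ^ 2 / 8) ^ N ≤ (N : ℝ) ^ N * Real.exp (t ^ 2 / 8) := by
      have h4 := Real.pow_div_factorial_le_exp (t ^ 2 / 8) (by positivity) N
      rw [div_le_iff₀ (by positivity)] at h4
      have h5 : (N.factorial : ℝ) ≤ (N : ℝ) ^ N := by exact_mod_cast Nat.factorial_le_pow N
      calc (t ^ 2 / 8) ^ N ≤ Real.exp (t ^ 2 / 8) * N.factorial := h4
        _ ≤ Real.exp (t ^ 2 / 8) * (N : ℝ) ^ N := by gcongr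
        _ = _ := by ring
    have h6 : ((s * t) ^ 2 / b ^ 2) ^ N
        ≤ (8 * N * s ^ 2 / b ^ 2) ^ N * Real.exp (t ^ 2 / 8) := by
      calc ((s * t) ^ 2 / b ^ 2) ^ N = (8 * s ^ 2 / b ^ 2) ^ N * (t ^ 2 / 8) ^ N := by
            rw [← mul_pow]; congr 1; ring
        _ ≤ (8 * s ^ 2 / b ^ 2) ^ N * ((N : ℝ) ^ N * Real.exp (t ^ 2 / 8)) := by gcongr
        _ = _ := by rw [← mul_assoc, ← mul_pow]; congr 2; ring
    have h7 : Real.exp (-(t ^ 2 / 4)) * Real.exp (t ^ 2 / 8) = Real.exp (-(t ^ 2 / (2 * 4))) := by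
      rw [← Real.exp_add]; congr 1; ring
    calc |hermiteKernel p t| * |∑ k ∈ Finset.range (2 * N), c k * s ^ k * t ^ k - F (x - s * t)|
        ≤ (2 * Real.exp 1 * ((p : ℝ) + 1) ^ 2 * Real.exp (-(t ^ 2 / 4)))
          * (D * ((8 * N * s ^ 2 / b ^ 2) ^ N * Real.exp (t ^ 2 / 8))) := by
          have := abs_hermiteKernel_le p t
          have h8 := h2.trans (mul_le_mul_of_nonneg_left h6 hD)
          gcongr
      _ = A * (Real.exp (-(t ^ 2 / 4)) * Real.exp (t ^ 2 / 8)) := by rw [hA]; ring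
      _ = _ := by rw [h7]
  have h := norm_integral_le_of_norm_le
    ((integrable_exp_neg_sq_div (by norm_num : (0 : ℝ) < 2 * 4)).const_mul A)
    (Filter.Eventually.of_forall hbd)
  rw [integral_const_mul, Real.norm_eq_abs] at h
  rw [abs_mul, abs_of_pos (by positivity : 0 < 1 / √(2 * Real.pi))]
  have h4 : √(4 : ℝ) = 2 := by
    rw [show (4 : ℝ) = 2 ^ 2 by norm_num, Real.sqrt_sq (by norm_num)]
  calc _ ≤ 1 / √(2 * Real.pi) * (A * ∫ t : ℝ, Real.exp (-(t ^ 2 / (2 * 4)))) := by gcongr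
    _ = A * (1 / √(2 * Real.pi) * ∫ t : ℝ, Real.exp (-(t ^ 2 / (2 * 4)))) := by ring
    _ = A * 2 := by rw [one_div_sqrt_mul_integral_exp 4, h4]
    _ = _ := by rw [hA]; ring

theorem jumpDist_pos {ξ x : ℝ} (hξ : ξ ∈ Set.Ioo (0 : ℝ) 1) (hx : x ∈ Set.Icc (0 : ℝ) 1)
    (hne : x ≠ ξ) : 0 < jumpDist ξ x := by
  refine lt_min (abs_pos.2 (sub_ne_zero.2 hne)) (sub_pos.2 (abs_lt.2 ⟨?_, ?_⟩))
  · linarith [hx.1, hξ.2]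
  · linarith [hx.2, hξ.1]

theorem jumpDist_le_half (ξ x : ℝ) : jumpDist ξ x ≤ 1 / 2 := by
  unfold jumpDist
  rcases le_total |x - ξ| (1 - |x - ξ|) with h | h
  · rw [min_eq_left h]; linarith
  · rw [min_eq_right h]; linarith

/-- Within the distance to the jump, the periodic extension is the translate of the single analytic
piece `g`, expanded at the representative of `x` in `[ξ, ξ + 1)`. -/
theorem periodicExt_sub_eq {g : ℝ → ℝ} {ξ : ℝ} (hξ : ξ ∈ Set.Ioo (0 : ℝ) 1) {x : ℝ}
    (hx : x ∈ Set.Icc (0 : ℝ) 1) {z : ℝ} (hz : |z| < jumpDist ξ x) :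
    periodicExt g ξ (x - z) = g (ξ + Int.fract (x - ξ) - z) := by
  have hx' : ∃ n : ℤ, ξ + Int.fract (x - ξ) = x + n :=
    ⟨-⌊x - ξ⌋, by rw [Int.fract]; push_cast; ring⟩
  obtain ⟨n, hn⟩ := hx'
  rw [← periodicExt_add_int g ξ (x - z) n, show x - z + n = x + n - z by ring, ← hn]
  refine periodicExt_eq_of_mem ?_
  obtain ⟨h1, h2⟩ := lt_min_iff.1 hz
  rcases lt_or_ge x ξ with h | h
  · have e : Int.fract (x - ξ) = x - ξ + 1 := by
      rw [← Int.fract_add_one, Int.fract_eq_self]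
      exact ⟨by linarith [hx.1, hξ.2], by linarith⟩
    rw [abs_of_neg (show x - ξ < 0 by linarith)] at h1 h2
    rw [e]
    exact ⟨by linarith [(abs_lt.1 h2).2], by linarith [(abs_lt.1 h1).1]⟩
  · have e : Int.fract (x - ξ) = x - ξ :=
      Int.fract_eq_self.2 ⟨by linarith, by linarith [hx.2, hξ.1]⟩
    rw [abs_of_nonneg (show 0 ≤ x - ξ by linarith)] at h1 h2
    rw [e]
    exact ⟨by linarith [(abs_lt.1 h1).2], by linarith [(abs_lt.1 h2).1]⟩

/-- The Taylor polynomials of the analytic piece approximate the jump function on the whole line,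
with error measured in units of the distance `d` to the jump: near `x` this is the Taylor
remainder, farther away both terms are dominated by the last power. -/
theorem exists_taylor_on_line {F : ℝ → ℝ} {M₀ M r d b x : ℝ} {c : ℕ → ℝ}
    (hF : ∀ y, |F y| ≤ M₀) (hM : 0 ≤ M) (hr : 0 < r) (hd : 0 < d) (hd1 : d ≤ 1) (hb : 0 < b)
    (hb1 : b ≤ 1 / 2) (hbr : b ≤ r / 4) (hc : ∀ k, |c k| ≤ M / r ^ k)
    (hT : ∀ z, |z| < d → |z| ≤ r / 2 → ∀ K : ℕ,
      |F (x - z) - ∑ k ∈ Finset.range K, c k * (-z) ^ k| ≤ 2 * M * (|z| / r) ^ K) (N : ℕ) (z : ℝ) :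
    |∑ k ∈ Finset.range (2 * N), c k * (-1) ^ k * z ^ k - F (x - z)|
      ≤ (2 * M + M₀) * (z ^ 2 / (b * d) ^ 2) ^ N := by
  have hM₀ : 0 ≤ M₀ := (abs_nonneg _).trans (hF 0)
  have hbd : 0 < b * d := by positivity
  have e : ∑ k ∈ Finset.range (2 * N), c k * (-1) ^ k * z ^ k
      = ∑ k ∈ Finset.range (2 * N), c k * (-z) ^ k :=
    Finset.sum_congr rfl fun k _ => by rw [neg_pow z]; ring
  have e2 : (z ^ 2 / (b * d) ^ 2) ^ N = (|z| / (b * d)) ^ (2 * N) := by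
    rw [pow_mul, div_pow |z|, sq_abs]
  rw [e, e2]
  by_cases h : |z| < d ∧ |z| ≤ r / 2
  · rw [abs_sub_comm]
    refine (hT z h.1 h.2 (2 * N)).trans ?_
    have h1 : |z| / r ≤ |z| / (b * d) := by
      refine div_le_div_of_nonneg_left (abs_nonneg z) hbd ?_
      nlinarith
    calc 2 * M * (|z| / r) ^ (2 * N) ≤ 2 * M * (|z| / (b * d)) ^ (2 * N) := by gcongr
      _ ≤ _ := by
        refine mul_le_mul_of_nonneg_right (by linarith) (by positivity)
  · have hz : 2 * (b * d) ≤ |z| := by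
      by_contra hlt
      push Not at hlt
      exact h ⟨by nlinarith, by nlinarith⟩
    set T := |z| / (b * d) with hTdef
    have hT2 : 2 ≤ T := by rw [hTdef, le_div_iff₀ hbd]; exact hz
    have hzr : |z| / r ≤ T / 2 := by
      rw [hTdef, div_div]
      refine div_le_div_of_nonneg_left (abs_nonneg z) (by positivity) ?_
      nlinarith
    have hsum : |∑ k ∈ Finset.range (2 * N), c k * (-z) ^ k| ≤ M * T ^ (2 * N) := by
      refine (Finset.abs_sum_le_sum_abs _ _).trans ?_
      have hk : ∀ k ∈ Finset.range (2 * N), |c k * (-z) ^ k| ≤ M * (T / 2) ^ (2 * N) := by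
        intro k hk
        rw [abs_mul, abs_pow, abs_neg]
        calc |c k| * |z| ^ k ≤ M / r ^ k * |z| ^ k := by gcongr; exact hc k
          _ = M * (|z| / r) ^ k := by rw [div_pow]; ring
          _ ≤ M * (T / 2) ^ k := by gcongr
          _ ≤ M * (T / 2) ^ (2 * N) := by
            gcongr
            · linarith
            · exact (Finset.mem_range.1 hk).le
      refine (Finset.sum_le_card_nsmul _ _ _ hk).trans ?_
      rw [Finset.card_range, nsmul_eq_mul, div_pow]
      have h2 : ((2 * N : ℕ) : ℝ) ≤ 2 ^ (2 * N) := by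
        exact_mod_cast (Nat.lt_two_pow_self).le
      calc ((2 * N : ℕ) : ℝ) * (M * (T ^ (2 * N) / 2 ^ (2 * N)))
          ≤ 2 ^ (2 * N) * (M * (T ^ (2 * N) / 2 ^ (2 * N))) := by gcongr
        _ = _ := by field_simp
    have h1 : (1 : ℝ) ≤ T ^ (2 * N) := one_le_pow₀ (by linarith)
    calc _ ≤ |∑ k ∈ Finset.range (2 * N), c k * (-z) ^ k| + |F (x - z)| := abs_sub _ _
      _ ≤ M * T ^ (2 * N) + M₀ * T ^ (2 * N) :=
        add_le_add hsum ((hF _).trans (le_mul_of_one_le_right hM₀ h1))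
      _ ≤ _ := by nlinarith [mul_nonneg hM (zero_le_one.trans h1)]

/-- A geometric factor absorbs polynomial growth, at the price of half its rate. -/
theorem sq_mul_two_rpow_neg_le {δ P : ℝ} (hδ : 0 < δ) (hδ1 : δ ≤ 1) (hP : 0 ≤ P) :
    (P + 1) ^ 2 * (2 : ℝ) ^ (-(δ * P)) ≤ 64 / δ ^ 2 * ((2 : ℝ) ^ (δ / 2)) ^ (-P) := by
  have hl := Real.log_two_gt_d9
  have hl2 := Real.log_two_lt_d9
  set a := δ * Real.log 2 / 2 with ha
  have ha0 : 0 < a := by positivity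
  have h1 : (P + 1) ^ 2 ≤ 64 / δ ^ 2 * Real.exp (a * P) := by
    have h2 := Real.quadratic_le_exp_of_nonneg (x := a * (P + 1)) (by positivity)
    have h3 : (a * (P + 1)) ^ 2 ≤ 2 * Real.exp (a * (P + 1)) := by
      have : 0 ≤ a * (P + 1) := by positivity
      linarith
    have h4 : Real.exp (a * (P + 1)) ≤ 3 * Real.exp (a * P) := by
      rw [mul_add, mul_one, Real.exp_add, mul_comm]
      have h5 : Real.exp a ≤ Real.exp 1 := Real.exp_le_exp.2 (by nlinarith)
      have h6 := Real.exp_one_lt_d9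
      exact mul_le_mul_of_nonneg_right (by linarith) (Real.exp_pos _).le
    have h7 : δ ^ 2 ≤ 10 * a ^ 2 := by
      have : δ * 0.34 ≤ a := by rw [ha]; nlinarith
      nlinarith [mul_pos hδ hδ]
    rw [div_mul_eq_mul_div, le_div_iff₀ (by positivity)]
    calc (P + 1) ^ 2 * δ ^ 2 ≤ (P + 1) ^ 2 * (10 * a ^ 2) := by gcongr
      _ = 10 * (a * (P + 1)) ^ 2 := by ring
      _ ≤ 64 * Real.exp (a * P) := by linarith [Real.exp_pos (a * P)]
  have e1 : (2 : ℝ) ^ (-(δ * P)) = Real.exp (-(2 * (a * P))) := by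
    rw [Real.rpow_def_of_pos two_pos]; congr 1; rw [ha]; ring
  have e2 : ((2 : ℝ) ^ (δ / 2)) ^ (-P) = Real.exp (-(a * P)) := by
    rw [← Real.rpow_mul two_pos.le, Real.rpow_def_of_pos two_pos]; congr 1; rw [ha]; ring
  rw [e1, e2]
  calc (P + 1) ^ 2 * Real.exp (-(2 * (a * P)))
      ≤ 64 / δ ^ 2 * Real.exp (a * P) * Real.exp (-(2 * (a * P))) := by gcongr
    _ = 64 / δ ^ 2 * Real.exp (-(a * P)) := by
      rw [mul_assoc, ← Real.exp_add]; congr 2; ring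

/-- The ratio of the geometric series at scale `s = γ / (2πm)`, for `N ≤ 2 b² κ d m`; the factors of
`d` and `m` cancel, leaving `α κ`. -/
theorem scale_ratio_le {α κ d m b γ N : ℝ} (hα : 0 < α) (hκ : 0 < κ) (hακ : α * κ ≤ 1)
    (hd : 0 < d) (hm : 0 < m) (hb : 0 < b) (hγ : γ ^ 2 = α * d * m)
    (hN : N ≤ 2 * (b ^ 2 * (κ * d * m))) :
    8 * N * (γ / (2 * Real.pi * m)) ^ 2 / (b * d) ^ 2 ≤ 1 / 2 := by
  have hpi := Real.pi_gt_three
  have e : 8 * (2 * (b ^ 2 * (κ * d * m))) * (γ / (2 * Real.pi * m)) ^ 2 / (b * d) ^ 2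
      = 4 * (α * κ) / Real.pi ^ 2 := by
    rw [div_pow, hγ]
    field_simp
    ring
  calc 8 * N * (γ / (2 * Real.pi * m)) ^ 2 / (b * d) ^ 2
      ≤ 8 * (2 * (b ^ 2 * (κ * d * m))) * (γ / (2 * Real.pi * m)) ^ 2 / (b * d) ^ 2 := by gcongr
    _ = 4 * (α * κ) / Real.pi ^ 2 := e
    _ ≤ 1 / 2 := by
      rw [div_le_iff₀ (by positivity)]
      nlinarith

/-- Exponential accuracy of the adaptive mollification, with a rate and constant depending only on
the function. The Taylor degree used is a small fraction `δ` of the order: small enough that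
the Gaussian moments of that degree are harmless outside the disc of convergence. -/
theorem exists_mollify_error {f : ℝ → ℝ} {ξ : ℝ} (hξ : ξ ∈ Set.Ioo (0 : ℝ) 1)
    (hf : IsPiecewiseAnalytic f ξ) :
    ∃ C η : ℝ, 0 < C ∧ 1 < η ∧ ∀ α κ : ℝ, 0 < α → 0 < κ → α * κ ≤ 1 → ∀ m : ℕ, 1 ≤ m →
      ∀ x ∈ Set.Icc (0 : ℝ) 1, x ≠ ξ →
        ‖(f x : ℂ) - mollify m (orderX κ ξ m x) (gammaX α ξ m x) f x‖
          ≤ C * η ^ (-(κ * jumpDist ξ x * m)) := by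
  obtain ⟨g, hg, hg1, hg2⟩ := hf
  obtain ⟨M, r, hM, hr, hT⟩ := exists_hasGeometricTaylor_of_analyticOnNhd isCompact_Icc hg
  obtain ⟨M₀, hM₀⟩ := isCompact_Icc.exists_bound_of_continuousOn hg.continuousOn
  have hFb : ∀ y, |periodicExt g ξ y| ≤ M₀ := fun y => hM₀ _ (add_fract_mem_Icc ξ _)
  have hM₀' : 0 ≤ M₀ := (abs_nonneg _).trans (hFb 0)
  have hFm := measurable_periodicExt hg.continuousOn
  set F := periodicExt g ξ with hFdef
  set b := min (1 / 2) (r / 4) with hbdef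
  have hb : 0 < b := lt_min (by norm_num) (by positivity)
  have hb1 : b ≤ 1 / 2 := min_le_left _ _
  set δ := b ^ 2 with hδdef
  have hδ : 0 < δ := by positivity
  have hδ1 : δ ≤ 1 := by nlinarith
  set D := 2 * M + M₀ with hD
  have hD0 : 0 < D := by positivity
  set C₁ := 2 * (M₀ + 4 * Real.exp 1 * (1 / δ + 1) ^ 2 * M₀) with hC₁
  set C₂ := 4 * Real.exp 1 * D * (64 / δ ^ 2) with hC₂
  have hC₁0 : 0 ≤ C₁ := by positivity
  have hC₂0 : 0 < C₂ := by positivity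
  refine ⟨C₁ + C₂, 2 ^ (δ / 2), by positivity,
    Real.one_lt_rpow one_lt_two (by positivity), ?_⟩
  intro α κ hα hκ hακ m hm x hx hne
  have hm0 : (0 : ℝ) < m := by exact_mod_cast hm
  have hd := jumpDist_pos hξ hx hne
  have hd2 := jumpDist_le_half ξ x
  set d := jumpDist ξ x with hddef
  set P := κ * d * m with hPdef
  have hP : 0 < P := by positivity
  have hp : (orderX κ ξ m x : ℝ) ≤ P := Nat.floor_le hP.le
  have hp' : P < orderX κ ξ m x + 1 := Nat.lt_floor_add_one P
  set p := orderX κ ξ m x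
  have hγ : 0 < gammaX α ξ m x := Real.sqrt_pos.2 (by positivity)
  have hγ2 : gammaX α ξ m x ^ 2 = α * d * m := Real.sq_sqrt (by positivity)
  set γ := gammaX α ξ m x
  have hfx : f x = F x := eq_periodicExt hξ hg1 hg2 hx hne
  have hmol := intervalIntegral_mollifier_mul hFm hFb (fun y n => periodicExt_add_int g ξ y n)
    (fun y hy hyne => eq_periodicExt hξ hg1 hg2 hy hyne) hm p hγ x
  rw [mollify, hmol, hfx, ← Complex.ofReal_sub, Complex.norm_real, Real.norm_eq_abs]
  set s := γ / (2 * Real.pi * m) with hs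
  have hpow : 0 < ((2 : ℝ) ^ (δ / 2)) ^ (-P) := by positivity
  rcases lt_or_ge (δ * P) 1 with hsmall | hlarge
  · -- for bounded orders the trivial bound suffices
    have h1 := abs_hermiteKernel_average_le (F := fun t => F (x - s * t)) (fun y => hFb _) p
    have h2 : (p : ℝ) + 1 ≤ 1 / δ + 1 := by
      have : P ≤ 1 / δ := by rw [le_div_iff₀ hδ]; linarith
      linarith
    have h3 : (1 : ℝ) ≤ 2 * ((2 : ℝ) ^ (δ / 2)) ^ (-P) := by
      rw [← Real.rpow_mul two_pos.le]
      calc (1 : ℝ) = 2 * 2 ^ (-1 : ℝ) := by norm_num [Real.rpow_neg_one]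
        _ ≤ _ := by
          gcongr
          · norm_num
          · linarith
    calc _ ≤ |F x| + _ := abs_sub _ _
      _ ≤ M₀ + 4 * Real.exp 1 * ((p : ℝ) + 1) ^ 2 * M₀ := add_le_add (hFb x) h1
      _ ≤ M₀ + 4 * Real.exp 1 * (1 / δ + 1) ^ 2 * M₀ := by gcongr
      _ ≤ (M₀ + 4 * Real.exp 1 * (1 / δ + 1) ^ 2 * M₀) * (2 * ((2 : ℝ) ^ (δ / 2)) ^ (-P)) :=
        le_mul_of_one_le_right (by positivity) h3
      _ = C₁ * ((2 : ℝ) ^ (δ / 2)) ^ (-P) := by rw [hC₁]; ring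
      _ ≤ _ := mul_le_mul_of_nonneg_right (by linarith) hpow.le
  · obtain ⟨c, hc0, hc, hcT⟩ := hT (ξ + Int.fract (x - ξ)) (add_fract_mem_Icc ξ _)
    set N := ⌊δ * P⌋₊ + 1 with hN
    have hNle : (N : ℝ) ≤ 2 * (δ * P) := by
      rw [hN]; push_cast
      linarith [Nat.floor_le (by positivity : 0 ≤ δ * P)]
    have hNge : δ * P ≤ N := by
      rw [hN]; push_cast
      exact (Nat.lt_floor_add_one _).le
    have hNp : N ≤ p + 1 := by
      have : ⌊δ * P⌋₊ ≤ p := Nat.floor_le_floor (by nlinarith)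
      omega
    have hE := exists_taylor_on_line (F := F) (x := x) (d := d) hFb hM.le hr hd (by linarith) hb
      hb1 (min_le_right _ _) hc (by
        intro z hz1 hz2 K
        have h := hcT (ξ + Int.fract (x - ξ) - z) (by
          rw [sub_sub_cancel_left, abs_neg]; exact hz2) K
        rw [sub_sub_cancel_left, abs_neg] at h
        rw [hFdef, periodicExt_sub_eq hξ hx hz1]
        exact h) N
    have h := abs_sub_hermiteKernel_average_le hFm hFb (x := x) (s := s)
      (by positivity : 0 < b * d) (p := p) (by omega : 1 ≤ N) hNp
      (c := fun k => c k * (-1) ^ k) (by rw [pow_zero, mul_one, hc0, hFdef, periodicExt]) hE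
    refine h.trans ?_
    have hratio : 8 * N * s ^ 2 / (b * d) ^ 2 ≤ 1 / 2 :=
      scale_ratio_le hα hκ hακ hd hm0 hb hγ2 (hNle.trans_eq (by rw [hδdef, hPdef]))
    have hhalf : (8 * N * s ^ 2 / (b * d) ^ 2) ^ N ≤ (2 : ℝ) ^ (-(δ * P)) := by
      calc (8 * N * s ^ 2 / (b * d) ^ 2) ^ N ≤ (1 / 2 : ℝ) ^ N := by gcongr
        _ = (2 : ℝ) ^ (-(N : ℝ)) := by
          rw [Real.rpow_neg two_pos.le, Real.rpow_natCast, one_div, inv_pow]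
        _ ≤ _ := by
          gcongr
          norm_num
    calc 4 * Real.exp 1 * ((p : ℝ) + 1) ^ 2 * D * (8 * N * s ^ 2 / (b * d) ^ 2) ^ N
        ≤ 4 * Real.exp 1 * (P + 1) ^ 2 * D * (2 : ℝ) ^ (-(δ * P)) := by gcongr
      _ = 4 * Real.exp 1 * D * ((P + 1) ^ 2 * (2 : ℝ) ^ (-(δ * P))) := by ring
      _ ≤ 4 * Real.exp 1 * D * (64 / δ ^ 2 * ((2 : ℝ) ^ (δ / 2)) ^ (-P)) := by
        have := sq_mul_two_rpow_neg_le hδ hδ1 hP.le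
        gcongr
      _ = C₂ * ((2 : ℝ) ^ (δ / 2)) ^ (-P) := by rw [hC₂]; ring
      _ ≤ _ := mul_le_mul_of_nonneg_right (by linarith) hpow.le

/-! ### Absolutely convergent Fourier series -/

theorem expo_eq_fourier (l : ℤ) (x : ℝ) : expo l x = fourier l (x : UnitAddCircle) := by
  rw [fourier_coe_apply, expo]
  push_cast
  congr 1
  ring

theorem norm_expo (t x : ℝ) : ‖expo t x‖ = 1 := by
  rw [expo, show (2 * Real.pi * Complex.I * t * x : ℂ) = ((2 * Real.pi * t * x : ℝ) : ℂ) * Complex.I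
    by push_cast; ring, Complex.norm_exp_ofReal_mul_I]

theorem conj_expo (t x : ℝ) : (starRingEnd ℂ) (expo t x) = expo (-t) x := by
  have h2 : (starRingEnd ℂ) 2 = 2 := map_ofNat _ 2
  rw [expo, expo, ← Complex.exp_conj]
  simp [h2]

theorem expo_mul_expo (s t x : ℝ) : expo s x * expo t x = expo (s + t) x := by
  rw [expo, expo, expo, ← Complex.exp_add]
  congr 1
  push_cast
  ring

theorem fourierCoeffOn_eq_ip (g : ℝ → ℂ) (l : ℤ) :
    fourierCoeffOn zero_lt_one g l = ip g (expo l) := by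
  rw [fourierCoeffOn_eq_integral, ip]
  rw [sub_zero, div_one, one_smul]
  refine intervalIntegral.integral_congr fun x _ => ?_
  simp only [conj_expo, smul_eq_mul]
  rw [mul_comm, ← Int.cast_neg, expo_eq_fourier]

theorem hasSum_sq_ip {g : ℝ → ℂ} (hg : MemLp g 2 (volume.restrict (Set.Ioc (0 : ℝ) 1))) :
    HasSum (fun l : ℤ => ‖ip g (expo l)‖ ^ 2) (∫ x in (0 : ℝ)..1, ‖g x‖ ^ 2) := by
  have h := hasSum_sq_fourierCoeffOn zero_lt_one hg
  simpa [fourierCoeffOn_eq_ip] using h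

theorem memLp_of_continuous {g : ℝ → ℂ} (hg : Continuous g) :
    MemLp g 2 (volume.restrict (Set.Icc (0 : ℝ) 1)) := by
  obtain ⟨C, hC⟩ := isCompact_Icc.exists_bound_of_continuousOn
    (hg.continuousOn (s := Set.Icc (0 : ℝ) 1))
  exact MemLp.of_bound hg.aestronglyMeasurable C
    ((ae_restrict_iff' measurableSet_Icc).2 (Filter.Eventually.of_forall hC))

theorem memLp_Ioc_of_continuous {g : ℝ → ℂ} (hg : Continuous g) :
    MemLp g 2 (volume.restrict (Set.Ioc (0 : ℝ) 1)) :=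
  (memLp_of_continuous hg).mono_measure (Measure.restrict_mono Set.Ioc_subset_Icc_self le_rfl)

theorem ip_expo_expo (s t : ℝ) : ip (expo s) (expo t) = ∫ x in (0 : ℝ)..1, expo (s - t) x := by
  unfold ip
  simp only [conj_expo, expo_mul_expo, sub_eq_add_neg]

theorem integral_expo {t : ℝ} (ht : t ≠ 0) :
    ∫ x in (0 : ℝ)..1, expo t x
      = (Complex.exp (2 * Real.pi * Complex.I * t) - 1) / (2 * Real.pi * Complex.I * t) := by
  unfold expo
  rw [integral_exp_mul_complex]
  · simp
  · have : (t : ℂ) ≠ 0 := by exact_mod_cast ht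
    have := Real.pi_ne_zero
    simp_all

theorem ip_expo_int (k l : ℤ) : ip (expo k) (expo l) = if k = l then 1 else 0 := by
  rw [ip_expo_expo]
  split_ifs with h
  · subst h
    simp [expo]
  · have h' : ((k : ℝ) - l) ≠ 0 := by
      rw [sub_ne_zero]; exact_mod_cast h
    rw [integral_expo h']
    have : Complex.exp (2 * Real.pi * Complex.I * ((k : ℝ) - l : ℝ)) = 1 := by
      rw [Complex.exp_eq_one_iff]
      exact ⟨k - l, by push_cast; ring⟩
    rw [this, sub_self, zero_div]

section FourierSeries

variable {a : ℤ → ℂ} {h : ℝ → ℂ}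

theorem continuous_of_hasSum_expo (ha : Summable fun l => ‖a l‖)
    (hs : ∀ x, HasSum (fun l : ℤ => a l * expo l x) (h x)) : Continuous h := by
  have e : h = fun x => ∑' l : ℤ, a l * expo l x := funext fun x => (hs x).tsum_eq.symm
  rw [e]
  refine continuous_tsum (fun l => continuous_const.mul (expo_continuous _)) ha fun l x => ?_
  rw [norm_mul, norm_expo, mul_one]

theorem ip_of_hasSum_expo (ha : Summable fun l => ‖a l‖)
    (hs : ∀ x, HasSum (fun l : ℤ => a l * expo l x) (h x)) (t : ℝ) :
    HasSum (fun l : ℤ => a l * ip (expo l) (expo t)) (ip h (expo t)) := by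
  have key := hasSum_integral_of_summable_integral_norm (μ := volume.restrict (Set.Ioc (0 : ℝ) 1))
    (F := fun (l : ℤ) x => a l * expo l x * (starRingEnd ℂ) (expo t x)) (fun l => by
      have hc : Continuous fun x => a l * expo l x * (starRingEnd ℂ) (expo t x) :=
        (continuous_const.mul (expo_continuous _)).mul
          (Complex.continuous_conj.comp (expo_continuous _))
      exact (hc.integrableOn_Icc (a := 0) (b := 1)).mono_set Set.Ioc_subset_Icc_self) (by
      simpa [norm_expo, RCLike.norm_conj] using ha)
  have e1 : ∀ l : ℤ, (∫ x in Set.Ioc (0 : ℝ) 1, a l * expo l x * (starRingEnd ℂ) (expo t x))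
      = a l * ip (expo l) (expo t) := by
    intro l
    rw [ip, intervalIntegral.integral_of_le zero_le_one, ← integral_const_mul]
    simp only [mul_assoc]
  have e2 : (∫ x in Set.Ioc (0 : ℝ) 1, ∑' l : ℤ, a l * expo l x * (starRingEnd ℂ) (expo t x))
      = ip h (expo t) := by
    rw [ip, intervalIntegral.integral_of_le zero_le_one]
    congr 1
    funext x
    rw [tsum_mul_right, (hs x).tsum_eq]
  simp only [e1, e2] at key
  exact key

theorem ip_expo_of_hasSum_expo (ha : Summable fun l => ‖a l‖)
    (hs : ∀ x, HasSum (fun l : ℤ => a l * expo l x) (h x)) (l : ℤ) : ip h (expo l) = a l := by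
  have h1 := ip_of_hasSum_expo ha hs l
  have h2 : HasSum (fun k : ℤ => a k * ip (expo k) (expo l)) (a l * ip (expo l) (expo l)) :=
    hasSum_single l fun k hk => by rw [ip_expo_int, if_neg hk, mul_zero]
  rw [ip_expo_int, if_pos rfl, mul_one] at h2
  exact h1.unique h2

theorem integral_sq_of_hasSum_expo (ha : Summable fun l => ‖a l‖)
    (hs : ∀ x, HasSum (fun l : ℤ => a l * expo l x) (h x)) :
    HasSum (fun l => ‖a l‖ ^ 2) (∫ x in (0 : ℝ)..1, ‖h x‖ ^ 2) := by
  have := hasSum_sq_ip (memLp_Ioc_of_continuous (continuous_of_hasSum_expo ha hs))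
  simpa only [ip_expo_of_hasSum_expo ha hs] using this

end FourierSeries

/-! ### The mollifier as a Fourier multiplier -/

theorem hdafFilter_nonneg (p : ℕ) (w : ℝ) : 0 ≤ hdafFilter p w := by
  unfold hdafFilter
  positivity

theorem exp_neg_le_inv {x : ℝ} (hx : 0 < x) : Real.exp (-x) ≤ 1 / x := by
  rw [Real.exp_neg, ← one_div]
  exact one_div_le_one_div_of_le hx (by linarith [Real.add_one_le_exp x])

theorem hdafFilter_le (p : ℕ) (w : ℝ) : hdafFilter p w ≤ 2 ^ p * Real.exp (-(w ^ 2 / 4)) := by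
  unfold hdafFilter
  have h1 : ∑ l ∈ Finset.range (p + 1), (w ^ 2 / 2) ^ l / (l.factorial : ℝ)
      ≤ 2 ^ p * Real.exp (w ^ 2 / 4) := by
    have h2 := Real.sum_le_exp_of_nonneg (x := w ^ 2 / 4) (by positivity) (p + 1)
    calc ∑ l ∈ Finset.range (p + 1), (w ^ 2 / 2) ^ l / (l.factorial : ℝ)
        ≤ ∑ l ∈ Finset.range (p + 1), 2 ^ p * ((w ^ 2 / 4) ^ l / (l.factorial : ℝ)) := by
          refine Finset.sum_le_sum fun l hl => ?_
          rw [show w ^ 2 / 2 = 2 * (w ^ 2 / 4) by ring, mul_pow, mul_div_assoc]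
          gcongr
          · norm_num
          · exact Nat.lt_succ_iff.1 (Finset.mem_range.1 hl)
      _ = 2 ^ p * ∑ l ∈ Finset.range (p + 1), (w ^ 2 / 4) ^ l / (l.factorial : ℝ) := by
          rw [Finset.mul_sum]
      _ ≤ _ := by gcongr
  calc _ ≤ Real.exp (-(w ^ 2 / 2)) * (2 ^ p * Real.exp (w ^ 2 / 4)) := by gcongr
    _ = 2 ^ p * (Real.exp (-(w ^ 2 / 2)) * Real.exp (w ^ 2 / 4)) := by ring
    _ = _ := by rw [← Real.exp_add]; congr 2; ring

theorem summable_hdafFilter (p : ℕ) {b : ℝ} (hb : 0 < b) :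
    Summable fun l : ℤ => hdafFilter p (l * b) := by
  have hs := (Real.summable_one_div_int_pow (p := 2)).2 one_lt_two
  refine Summable.of_norm_bounded_eventually (hs.mul_left (2 ^ p * (4 / b ^ 2))) ?_
  have h0 : ∀ᶠ l : ℤ in Filter.cofinite, l ≠ 0 :=
    (Set.finite_singleton (0 : ℤ)).compl_mem_cofinite
  filter_upwards [h0] with l hl
  have hl' : (l : ℝ) ≠ 0 := by exact_mod_cast hl
  rw [Real.norm_of_nonneg (hdafFilter_nonneg _ _)]
  refine (hdafFilter_le p _).trans ?_
  have h1 : 0 < ((l : ℝ) * b) ^ 2 / 4 := by positivity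
  calc 2 ^ p * Real.exp (-(((l : ℝ) * b) ^ 2 / 4)) ≤ 2 ^ p * (1 / (((l : ℝ) * b) ^ 2 / 4)) := by
        gcongr
        exact exp_neg_le_inv h1
    _ = _ := by field_simp

open FourierTransform in
/-- Poisson summation: the Fourier coefficients of the mollifier are the samples of the filter. -/
theorem hasSum_mollifier {m : ℕ} (hm : 1 ≤ m) (p : ℕ) {γ : ℝ} (hγ : 0 < γ) (y : ℝ) :
    HasSum (fun l : ℤ => (hdafFilter p (l * (γ / m)) : ℂ) * expo l y) (mollifier m p γ y : ℂ) := by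
  have hm0 : (0 : ℝ) < m := by exact_mod_cast hm
  set q := 2 * Real.pi * m / γ with hq
  have hq0 : 0 < q := by positivity
  set c := √(2 * Real.pi) * m / γ with hc
  let K : ℝ → ℂ := fun z => ((c * hermiteKernel p (q * z) : ℝ) : ℂ)
  have hKc : Continuous K := by
    have := continuous_hermiteKernel p
    fun_prop
  have hF : ∀ l : ℤ, 𝓕 K (l : ℝ) = (hdafFilter p (l * (γ / m)) : ℂ) := by
    intro l
    rw [Real.fourier_real_eq_integral_exp_smul]
    have h1 := Measure.integral_comp_mul_left (fun t : ℝ => (hermiteKernel p t : ℂ)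
      * Complex.exp (-(Complex.I * ((l * (γ / m) : ℝ) : ℂ) * t))) q
    rw [integral_hermiteKernel_mul_cexp] at h1
    have e : ∀ v : ℝ, Complex.exp (((-2 * Real.pi * v * l : ℝ) : ℂ) * Complex.I) • K v
        = (c : ℂ) * ((hermiteKernel p (q * v) : ℂ)
          * Complex.exp (-(Complex.I * ((l * (γ / m) : ℝ) : ℂ) * ((q * v : ℝ) : ℂ)))) := by
      intro v
      have e1 : -(Complex.I * ((l * (γ / m) : ℝ) : ℂ) * ((q * v : ℝ) : ℂ))
          = ((-2 * Real.pi * v * l : ℝ) : ℂ) * Complex.I := by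
        have : (l * (γ / m)) * (q * v) = 2 * Real.pi * v * l := by
          rw [hq]; field_simp
        rw [mul_assoc, ← Complex.ofReal_mul, this]
        push_cast
        ring
      rw [e1, smul_eq_mul]
      simp only [K, Complex.ofReal_mul]
      ring
    simp_rw [e]
    rw [integral_const_mul, h1, abs_of_pos (inv_pos.2 hq0), Complex.real_smul,
      ← Complex.ofReal_mul, ← Complex.ofReal_mul]
    congr 1
    have h2 : √(2 * Real.pi) * √(2 * Real.pi) = 2 * Real.pi := Real.mul_self_sqrt (by positivity)
    have h3 : c * q⁻¹ * √(2 * Real.pi) = 1 := by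
      rw [hc, hq]
      field_simp
      rw [pow_two, h2]
    calc c * (q⁻¹ * (√(2 * Real.pi) * hdafFilter p (l * (γ / m))))
        = c * q⁻¹ * √(2 * Real.pi) * hdafFilter p (l * (γ / m)) := by ring
      _ = _ := by rw [h3, one_mul]
  have hsum0 := summable_hdafFilter p (b := γ / m) (by positivity)
  have hsum : Summable fun l : ℤ => 𝓕 K (l : ℝ) := by
    simp_rw [hF]
    exact_mod_cast hsum0
  have hO : K =O[Filter.cocompact ℝ] fun x : ℝ => |x| ^ (-(2 : ℝ)) := by
    refine Asymptotics.IsBigO.of_bound (c * (2 * Real.exp 1 * ((p : ℝ) + 1) ^ 2) * (4 / q ^ 2)) ?_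
    have h0 : ∀ᶠ z : ℝ in Filter.cocompact ℝ, z ≠ 0 :=
      (isCompact_singleton (x := (0 : ℝ))).compl_mem_cocompact
    filter_upwards [h0] with z hz
    have hc0 : 0 < c := by positivity
    have hz' : 0 < |z| := abs_pos.2 hz
    have h1 : 0 < (q * z) ^ 2 / 4 := by positivity
    rw [Complex.norm_real, norm_mul, Real.norm_of_nonneg hc0.le, Real.norm_eq_abs,
      Real.norm_of_nonneg (by positivity), Real.rpow_neg hz'.le, Real.rpow_two, sq_abs]
    calc c * |hermiteKernel p (q * z)|
        ≤ c * (2 * Real.exp 1 * ((p : ℝ) + 1) ^ 2 * (1 / ((q * z) ^ 2 / 4))) := by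
          have h2 := abs_hermiteKernel_le p (q * z)
          have h3 := exp_neg_le_inv h1
          refine mul_le_mul_of_nonneg_left (h2.trans ?_) hc0.le
          gcongr
      _ = _ := by field_simp
  have hP := Real.tsum_eq_tsum_fourier_of_rpow_decay_of_summable hKc one_lt_two hO hsum y
  have e1 : (mollifier m p γ y : ℂ) = ∑' n : ℤ, K (y + n) := by
    rw [mollifier_eq_tsum, Complex.ofReal_tsum]
  rw [e1, hP]
  simp_rw [hF, ← expo_eq_fourier]
  refine Summable.hasSum (Summable.of_norm ?_)
  refine hsum0.congr fun l => ?_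
  rw [norm_mul, norm_expo, mul_one, Complex.norm_real, Real.norm_of_nonneg (hdafFilter_nonneg _ _)]

theorem hasSum_mollify {f : ℝ → ℝ} (hf : IntegrableOn f (Set.Ioc (0 : ℝ) 1)) {m : ℕ} (hm : 1 ≤ m)
    (p : ℕ) {γ : ℝ} (hγ : 0 < γ) (x : ℝ) :
    HasSum (fun l : ℤ => (hdafFilter p (l * (γ / m)) : ℂ) * ip (fun y => (f y : ℂ)) (expo l)
      * expo l x) (mollify m p γ f x) := by
  have hm0 : (0 : ℝ) < m := by exact_mod_cast hm
  have hsum0 := summable_hdafFilter p (b := γ / m) (by positivity)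
  have key := hasSum_integral_of_summable_integral_norm (μ := volume.restrict (Set.Ioc (0 : ℝ) 1))
    (F := fun (l : ℤ) y => (hdafFilter p (l * (γ / m)) : ℂ) * expo l (x - y) * (f y : ℂ))
    (fun l => by
      have hc : Continuous fun y => (hdafFilter p (l * (γ / m)) : ℂ) * expo l (x - y) :=
        continuous_const.mul ((expo_continuous _).comp (continuous_const.sub continuous_id))
      refine hf.ofReal.bdd_mul hc.aestronglyMeasurable (c := hdafFilter p (l * (γ / m)))
        (Filter.Eventually.of_forall fun y => ?_)
      rw [norm_mul, norm_expo, mul_one, Complex.norm_real,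
        Real.norm_of_nonneg (hdafFilter_nonneg _ _)]) (by
      simp only [norm_mul, norm_expo, mul_one, Complex.norm_real,
        Real.norm_of_nonneg (hdafFilter_nonneg _ _), integral_const_mul]
      exact hsum0.mul_right _)
  have e2 : (∫ y in Set.Ioc (0 : ℝ) 1,
      ∑' l : ℤ, (hdafFilter p (l * (γ / m)) : ℂ) * expo l (x - y) * (f y : ℂ))
      = mollify m p γ f x := by
    rw [mollify, intervalIntegral.integral_of_le zero_le_one, ← integral_complex_ofReal]
    congr 1
    funext y
    rw [tsum_mul_right, (hasSum_mollifier hm p hγ (x - y)).tsum_eq, Complex.ofReal_mul]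
  have e1 : ∀ l : ℤ, (∫ y in Set.Ioc (0 : ℝ) 1,
      (hdafFilter p (l * (γ / m)) : ℂ) * expo l (x - y) * (f y : ℂ))
      = (hdafFilter p (l * (γ / m)) : ℂ) * ip (fun y => (f y : ℂ)) (expo l) * expo l x := by
    intro l
    rw [ip, intervalIntegral.integral_of_le zero_le_one, mul_assoc, mul_comm _ (expo l x),
      ← mul_assoc, ← integral_const_mul]
    congr 1
    funext y
    have : expo l (x - y) = expo l x * (starRingEnd ℂ) (expo l y) := by
      rw [conj_expo, expo, expo, expo, ← Complex.exp_add]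
      congr 1
      push_cast
      ring
    rw [this]
    ring
  simp only [e1, e2] at key
  exact key

/-! ### Symmetric sums over the integers -/

/-- A sum over frequencies beyond `n` is at most twice the one-sided sum. -/
theorem exists_sum_natAbs_le {u : ℕ → ℝ} (hu : ∀ k, 0 ≤ u k) (n : ℕ) (s : Finset ℤ) :
    ∃ J : ℕ, ∑ l ∈ s with n < l.natAbs, u l.natAbs
      ≤ 2 * ∑ i ∈ Finset.range J, u (n + 1 + i) := by
  refine ⟨s.sup Int.natAbs, ?_⟩
  set J := s.sup Int.natAbs with hJ
  have hsub : s.filter (fun l => n < l.natAbs)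
      ⊆ (Finset.range J).image (fun i : ℕ => ((n + 1 + i : ℕ) : ℤ))
        ∪ (Finset.range J).image (fun i : ℕ => -((n + 1 + i : ℕ) : ℤ)) := by
    intro l hl
    obtain ⟨hls, hln⟩ := Finset.mem_filter.1 hl
    have hlJ : l.natAbs ≤ J := Finset.le_sup (f := Int.natAbs) hls
    rw [Finset.mem_union, Finset.mem_image, Finset.mem_image]
    rcases le_total 0 l with h | h
    · exact Or.inl ⟨l.natAbs - (n + 1), Finset.mem_range.2 (by omega), by omega⟩
    · exact Or.inr ⟨l.natAbs - (n + 1), Finset.mem_range.2 (by omega), by omega⟩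
  refine (Finset.sum_le_sum_of_subset_of_nonneg hsub fun l _ _ => hu _).trans ?_
  have h := Finset.sum_union_inter
    (s₁ := (Finset.range J).image (fun i : ℕ => ((n + 1 + i : ℕ) : ℤ)))
    (s₂ := (Finset.range J).image (fun i : ℕ => -((n + 1 + i : ℕ) : ℤ)))
    (f := fun l : ℤ => u l.natAbs)
  rw [Finset.sum_image (fun i _ j _ hij => by simpa using hij),
    Finset.sum_image (fun i _ j _ hij => by simpa using hij)] at h
  simp only [Int.natAbs_neg, Int.natAbs_natCast] at h
  have h0 : 0 ≤ ∑ l ∈ (Finset.range J).image (fun i : ℕ => ((n + 1 + i : ℕ) : ℤ))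
      ∩ (Finset.range J).image (fun i : ℕ => -((n + 1 + i : ℕ) : ℤ)), u l.natAbs :=
    Finset.sum_nonneg fun l _ => hu _
  linarith

/-- Telescoping: `1/t² ≤ 1/(t - 1/2) - 1/(t + 1/2)`. -/
theorem sum_inv_sq_le {z : ℝ} (hz : 1 / 2 < z) (J : ℕ) :
    ∑ i ∈ Finset.range J, 1 / (z + i) ^ 2 ≤ 1 / (z - 1 / 2) := by
  have h : ∀ J : ℕ, ∑ i ∈ Finset.range J, 1 / (z + i) ^ 2
      ≤ 1 / (z - 1 / 2) - 1 / (z - 1 / 2 + J) := by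
    intro J
    induction J with
    | zero => simp
    | succ J ih =>
      rw [Finset.sum_range_succ]
      have hJ : (0 : ℝ) ≤ J := by positivity
      have h1 : 0 < z - 1 / 2 + J := by linarith
      have h2 : 0 < z + J := by linarith
      have : 1 / (z + J) ^ 2 ≤ 1 / (z - 1 / 2 + J) - 1 / (z - 1 / 2 + (J + 1 : ℕ)) := by
        push_cast
        have h3 : 0 < z - 1 / 2 + (J + 1) := by linarith
        rw [div_sub_div _ _ h1.ne' h3.ne', div_le_div_iff₀ (by positivity) (by positivity)]
        nlinarith
      linarith
  refine (h J).trans ?_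
  have hJ : (0 : ℝ) ≤ J := by positivity
  have : 0 ≤ 1 / (z - 1 / 2 + J) := one_div_nonneg.2 (by linarith)
  linarith

theorem mem_Icc_iff_natAbs {n : ℕ} {l : ℤ} : l ∈ Finset.Icc (-(n : ℤ)) n ↔ l.natAbs ≤ n := by
  rw [Finset.mem_Icc]
  omega

theorem card_Icc_neg (n : ℕ) : ((Finset.Icc (-(n : ℤ)) n).card : ℝ) = 2 * n + 1 := by
  rw [Int.card_Icc, show ((n : ℤ) + 1 - -(n : ℤ)).toNat = 2 * n + 1 by omega]
  push_cast
  ring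

/-- Splitting off the low frequencies when the tail decays quadratically. -/
theorem tsum_le_sum_Icc_add {q : ℤ → ℝ} (hq : Summable q) {m : ℕ} {c y : ℝ} (hc : 0 ≤ c)
    (hy : y < m + 1 / 2)
    (hb : ∀ j : ℤ, m < j.natAbs → q j ≤ c * (1 / ((j.natAbs : ℝ) - y) ^ 2)) :
    ∑' j, q j ≤ ∑ j ∈ Finset.Icc (-(m : ℤ)) m, q j + 2 * c / (m + 1 / 2 - y) := by
  rw [← hq.sum_add_tsum_compl (s := Finset.Icc (-(m : ℤ)) m), add_le_add_iff_left]
  refine (hq.subtype _).tsum_le_of_sum_le fun s => ?_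
  have hs : ∑ j ∈ s, q j = ∑ j ∈ s.map (Function.Embedding.subtype _), q j := by
    rw [Finset.sum_map]; rfl
  have hmem : ∀ j ∈ s.map (Function.Embedding.subtype _), m < j.natAbs := by
    intro j hj
    obtain ⟨i, -, rfl⟩ := Finset.mem_map.1 hj
    have := i.2
    simp only [Set.mem_compl_iff, Finset.mem_coe, mem_Icc_iff_natAbs, not_le] at this
    exact this
  change ∑ j ∈ s, q j ≤ _
  rw [hs]
  obtain ⟨J, hJ⟩ := exists_sum_natAbs_le (u := fun k => c * (1 / ((k : ℝ) - y) ^ 2))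
    (fun k => by positivity) m (s.map (Function.Embedding.subtype _))
  rw [Finset.filter_true_of_mem hmem] at hJ
  refine (Finset.sum_le_sum fun j hj => hb j (hmem j hj)).trans (hJ.trans ?_)
  have h1 := sum_inv_sq_le (z := m + 1 - y) (by linarith) J
  have h2 : ∑ i ∈ Finset.range J, c * (1 / (((m + 1 + i : ℕ) : ℝ) - y) ^ 2)
      = c * ∑ i ∈ Finset.range J, 1 / ((m : ℝ) + 1 - y + i) ^ 2 := by
    rw [Finset.mul_sum]
    refine Finset.sum_congr rfl fun i _ => ?_
    congr 3
    push_cast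
    ring
  rw [h2]
  calc 2 * (c * ∑ i ∈ Finset.range J, 1 / ((m : ℝ) + 1 - y + i) ^ 2)
      ≤ 2 * (c * (1 / (m + 1 - y - 1 / 2))) := by gcongr
    _ = _ := by
      rw [show (m : ℝ) + 1 - y - 1 / 2 = m + 1 / 2 - y by ring]
      ring

/-! ### Consequences of admissibility for exponential frames -/

theorem norm_integral_expo {t : ℝ} (ht : t ≠ 0) :
    ‖∫ x in (0 : ℝ)..1, expo t x‖ = |Real.sin (Real.pi * t)| / (Real.pi * |t|) := by
  have e : (2 * Real.pi * Complex.I * t : ℂ) = ((2 * Real.pi * t : ℝ) : ℂ) * Complex.I := by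
    push_cast; ring
  rw [integral_expo ht, norm_div, e, mul_comm _ Complex.I, Complex.norm_exp_I_mul_ofReal_sub_one,
    norm_mul, norm_mul, Complex.norm_I, one_mul, Complex.norm_real, Real.norm_eq_abs,
    Real.norm_eq_abs, Real.norm_eq_abs, abs_mul, abs_mul, abs_of_pos Real.pi_pos, abs_two,
    show 2 * Real.pi * t / 2 = Real.pi * t by ring, mul_assoc, mul_div_mul_left _ _ two_ne_zero]

theorem norm_integral_expo_le (t : ℝ) (ht : t ≠ 0) :
    ‖∫ x in (0 : ℝ)..1, expo t x‖ ≤ 1 / (Real.pi * |t|) := by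
  rw [norm_integral_expo ht]
  have := Real.abs_sin_le_one (Real.pi * t)
  gcongr

/-- Jordan's inequality. -/
theorem two_div_pi_le_norm_integral_expo {t : ℝ} (ht : |t| ≤ 1 / 2) :
    2 / Real.pi ≤ ‖∫ x in (0 : ℝ)..1, expo t x‖ := by
  have hpi := Real.pi_gt_three
  rcases eq_or_ne t 0 with rfl | h
  · have : ∫ x in (0 : ℝ)..1, expo 0 x = 1 := by simp [expo]
    rw [this, norm_one, div_le_one Real.pi_pos]
    linarith
  · rw [norm_integral_expo h, le_div_iff₀ (by positivity)]
    have h1 := Real.mul_le_sin (x := Real.pi * |t|) (by positivity) (by nlinarith)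
    refine h1.trans ?_
    rcases abs_cases t with ⟨e, -⟩ | ⟨e, -⟩
    · rw [e]; exact le_abs_self _
    · rw [e, mul_neg, Real.sin_neg]; exact neg_le_abs _

section Frame

variable {lam : ℤ → ℝ} {A B c₀ : ℝ}

/-- The integer nearest to `λ_j` carries a coefficient of size at least `2/π`. -/
theorem IsAdmissible.abs_sub_le (h : IsAdmissible lam c₀) (j : ℤ) :
    |lam j - j| ≤ Real.pi * c₀ / 2 - 1 / 2 ∧ 1 ≤ Real.pi * c₀ / 2 := by
  have hr := abs_sub_round (lam j)
  have h1 := two_div_pi_le_norm_integral_expo hr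
  have h2 := h.2 j (round (lam j))
  rw [ip_expo_expo] at h2
  have h3 := h1.trans h2
  set k : ℝ := |(j : ℝ) - round (lam j)| with hk
  have hk0 : 0 ≤ k := abs_nonneg _
  rw [← div_eq_mul_inv, div_le_div_iff₀ Real.pi_pos (by positivity)] at h3
  refine ⟨?_, by nlinarith [Real.pi_pos]⟩
  have h4 : |lam j - j| ≤ |lam j - round (lam j)| + k := by
    rw [hk, abs_sub_comm (j : ℝ)]
    exact _root_.abs_sub_le _ _ _
  linarith

theorem conj_ip (g h : ℝ → ℂ) : (starRingEnd ℂ) (ip g h) = ip h g := by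
  unfold ip
  rw [intervalIntegral.integral_of_le zero_le_one, intervalIntegral.integral_of_le zero_le_one,
    ← integral_conj]
  simp only [map_mul, Complex.conj_conj, mul_comm]

theorem norm_ip_comm (g h : ℝ → ℂ) : ‖ip g h‖ = ‖ip h g‖ := by
  rw [← conj_ip, RCLike.norm_conj]

theorem integral_norm_sq_expo (t : ℝ) : ∫ x in (0 : ℝ)..1, ‖expo t x‖ ^ 2 = 1 := by
  simp [norm_expo]

theorem IsFourierFrame.le_bound (h : IsFourierFrame lam A B) : A ≤ B := by
  obtain ⟨-, h1, h2⟩ := h.2.2 (expo 0) (memLp_of_continuous (expo_continuous _))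
  rw [integral_norm_sq_expo] at h1 h2
  linarith

/-- The frequencies `λ_j` have unit density, which caps the lower frame bound: average the frame
inequality over the Fourier modes `|l| ≤ N` and compare with Bessel's inequality for the `ψ_j`. -/
theorem IsFourierFrame.le_one (h : IsFourierFrame lam A B) (ha : IsAdmissible lam c₀) : A ≤ 1 := by
  have key : ∀ K : ℕ, A ≤ 1 + (2 + 2 * c₀ ^ 2) * (1 / ((K : ℝ) + 1 / 2)) := by
    intro K
    -- the window must outgrow the margin `K` lost at its ends, and `K` must grow as well
    set N := K ^ 2 with hN
    let q : ℤ → ℤ → ℝ := fun l j => ‖ip (expo l) (expo (lam j))‖ ^ 2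
    have hl : ∀ l ∈ Finset.Icc (-(N : ℤ)) N,
        A ≤ ∑ j ∈ Finset.Icc (-((N + K : ℕ) : ℤ)) (N + K : ℕ), q l j
          + 2 * c₀ ^ 2 / ((N + K : ℕ) + 1 / 2 - (N : ℝ)) := by
      intro l hl
      obtain ⟨hs, h1, -⟩ := h.2.2 (expo l) (memLp_of_continuous (expo_continuous _))
      rw [integral_norm_sq_expo, mul_one] at h1
      refine h1.trans (tsum_le_sum_Icc_add hs (by positivity) (by push_cast; linarith) ?_)
      intro j hj
      rw [norm_ip_comm]
      have h2 := ha.2 j l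
      rw [mem_Icc_iff_natAbs] at hl
      have h3 : (j.natAbs : ℝ) - N ≤ 1 + |(j : ℝ) - l| := by
        have e1 : (j.natAbs : ℝ) = |(j : ℝ)| := by rw [Nat.cast_natAbs, Int.cast_abs]
        have e2 : |(l : ℝ)| ≤ N := by
          rw [← Int.cast_abs, ← Nat.cast_natAbs]; exact_mod_cast hl
        have e3 := abs_sub_abs_le_abs_sub (j : ℝ) l
        rw [e1]
        linarith
      have h4 : 0 < (j.natAbs : ℝ) - N := by
        have : (N : ℝ) < j.natAbs := by exact_mod_cast (show N < j.natAbs by omega)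
        linarith
      have hc := ha.1
      calc ‖ip (expo (lam j)) (expo l)‖ ^ 2 ≤ (c₀ * (1 + |(j : ℝ) - l|)⁻¹) ^ 2 := by gcongr
        _ ≤ (c₀ * ((j.natAbs : ℝ) - N)⁻¹) ^ 2 := by gcongr
        _ = _ := by rw [mul_pow, inv_pow, one_div]
    have hsum := Finset.sum_le_sum hl
    rw [Finset.sum_add_distrib, Finset.sum_const, Finset.sum_const, Finset.sum_comm] at hsum
    have hB : ∀ j ∈ Finset.Icc (-((N + K : ℕ) : ℤ)) (N + K : ℕ),
        ∑ l ∈ Finset.Icc (-(N : ℤ)) N, q l j ≤ 1 := by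
      intro j _
      have h1 := hasSum_sq_ip (memLp_Ioc_of_continuous (expo_continuous (lam j)))
      rw [integral_norm_sq_expo] at h1
      have h2 := sum_le_hasSum (Finset.Icc (-(N : ℤ)) N) (fun _ _ => sq_nonneg _) h1
      simpa only [q, norm_ip_comm (expo (lam j))] using h2
    have hBsum := Finset.sum_le_sum hB
    simp only [Finset.sum_const, nsmul_eq_mul, card_Icc_neg] at hsum hBsum
    push_cast at hsum hBsum
    have e : (N : ℝ) + K + 1 / 2 - N = K + 1 / 2 := by ring
    rw [e] at hsum
    have hN0 : (0 : ℝ) ≤ N := by positivity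
    have hK0 : (0 : ℝ) ≤ K := by positivity
    have hKN : (N : ℝ) = (K : ℝ) ^ 2 := by rw [hN]; push_cast; ring
    have hfrac : 2 * (K : ℝ) ≤ (2 * N + 1) * (2 * (1 / ((K : ℝ) + 1 / 2))) := by
      rw [hKN]
      rw [mul_one_div, mul_div_assoc', le_div_iff₀ (by positivity)]
      nlinarith [sq_nonneg ((K : ℝ) - 1)]
    have hfin : (2 * (N : ℝ) + 1) * A
        ≤ (2 * N + 1) * (1 + (2 + 2 * c₀ ^ 2) * (1 / ((K : ℝ) + 1 / 2))) := by
      have e2 : 2 * c₀ ^ 2 / ((K : ℝ) + 1 / 2) = 2 * c₀ ^ 2 * (1 / ((K : ℝ) + 1 / 2)) := by ring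
      rw [e2] at hsum
      linarith
    exact le_of_mul_le_mul_left hfin (by positivity)
  have hlim : Filter.Tendsto (fun K : ℕ => 1 + (2 + 2 * c₀ ^ 2) * (1 / ((K : ℝ) + 1 / 2)))
      Filter.atTop (nhds (1 + (2 + 2 * c₀ ^ 2) * 0)) := by
    refine Filter.Tendsto.const_add _ (Filter.Tendsto.const_mul _ ?_)
    simp only [one_div]
    exact Filter.Tendsto.inv_tendsto_atTop
      (Filter.tendsto_atTop_add_const_right _ _ tendsto_natCast_atTop_atTop)
  rw [mul_zero, add_zero] at hlim
  exact ge_of_tendsto' hlim key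

end Frame

/-! ### Trigonometric polynomials -/

theorem exists_hasSum_of_mem_trigSpace {n : ℕ} {g : ℝ → ℂ} (hg : g ∈ trigSpace n) :
    ∃ a : ℤ → ℂ, (∀ l ∉ Finset.Icc (-(n : ℤ)) n, a l = 0) ∧
      ∀ x, HasSum (fun l : ℤ => a l * expo l x) (g x) := by
  induction hg using Submodule.span_induction with
  | mem g hg =>
    obtain ⟨l, hl, rfl⟩ := hg
    refine ⟨Pi.single l 1, fun k hk => ?_, fun x => ?_⟩
    · have : k ≠ l := by rintro rfl; exact hk (Finset.mem_Icc.2 hl)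
      simp [this]
    · have := hasSum_single (f := fun k : ℤ => (Pi.single l (1 : ℂ) : ℤ → ℂ) k * expo k x) l
        (fun k hk => by simp [hk])
      simpa using this
  | zero => exact ⟨0, fun _ _ => rfl, fun x => by simp⟩
  | add g h _ _ hg hh =>
    obtain ⟨a, ha, hga⟩ := hg
    obtain ⟨b, hb, hhb⟩ := hh
    refine ⟨a + b, fun l hl => by simp [ha l hl, hb l hl], fun x => ?_⟩
    simpa [add_mul] using (hga x).add (hhb x)
  | smul c g _ hg =>
    obtain ⟨a, ha, hga⟩ := hg
    refine ⟨c • a, fun l hl => by simp [ha l hl], fun x => ?_⟩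
    simpa [mul_assoc] using (hga x).mul_left c

section Trig

variable {n : ℕ} {v : ℝ → ℂ}

/-- A trigonometric polynomial in terms of its own Fourier coefficients. -/
theorem trigSpace_spec (hv : v ∈ trigSpace n) :
    (∀ x, v x = ∑ l ∈ Finset.Icc (-(n : ℤ)) n, ip v (expo l) * expo l x) ∧
      (∫ x in (0 : ℝ)..1, ‖v x‖ ^ 2 = ∑ l ∈ Finset.Icc (-(n : ℤ)) n, ‖ip v (expo l)‖ ^ 2) ∧
      ∀ t : ℝ, ip v (expo t) = ∑ l ∈ Finset.Icc (-(n : ℤ)) n,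
        ip v (expo l) * ip (expo l) (expo t) := by
  obtain ⟨a, ha, hs⟩ := exists_hasSum_of_mem_trigSpace hv
  have hsum : Summable fun l => ‖a l‖ :=
    summable_of_ne_finset_zero (s := Finset.Icc (-(n : ℤ)) n) fun l hl => by rw [ha l hl, norm_zero]
  have hc := ip_expo_of_hasSum_expo hsum hs
  simp only [hc]
  refine ⟨fun x => ?_, ?_, fun t => ?_⟩
  · exact (hs x).unique (hasSum_sum_of_ne_finset_zero fun l hl => by rw [ha l hl, zero_mul])
  · exact (integral_sq_of_hasSum_expo hsum hs).unique
      (hasSum_sum_of_ne_finset_zero fun l hl => by rw [ha l hl, norm_zero]; norm_num)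
  · exact (ip_of_hasSum_expo hsum hs t).unique
      (hasSum_sum_of_ne_finset_zero fun l hl => by rw [ha l hl, zero_mul])

theorem proj_apply (u : ℝ → ℂ) (x : ℝ) :
    (proj n u : ℝ → ℂ) x = ∑ l ∈ Finset.Icc (-(n : ℤ)) n, ip u (expo l) * expo l x := by
  simp [proj, Finset.sum_apply]

theorem ip_proj (u : ℝ → ℂ) {l : ℤ} (hl : l ∈ Finset.Icc (-(n : ℤ)) n) :
    ip (proj n u : ℝ → ℂ) (expo l) = ip u (expo l) := by
  let a : ℤ → ℂ := fun l => if l ∈ Finset.Icc (-(n : ℤ)) n then ip u (expo l) else 0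
  have ha : ∀ l ∉ Finset.Icc (-(n : ℤ)) n, a l = 0 := fun l hl => if_neg hl
  have hsum : Summable fun l => ‖a l‖ :=
    summable_of_ne_finset_zero (s := Finset.Icc (-(n : ℤ)) n) fun l hl => by rw [ha l hl, norm_zero]
  have hs : ∀ x, HasSum (fun l : ℤ => a l * expo l x) ((proj n u : ℝ → ℂ) x) := by
    intro x
    have h : HasSum (fun l : ℤ => a l * expo l x)
        (∑ l ∈ Finset.Icc (-(n : ℤ)) n, a l * expo l x) :=
      hasSum_sum_of_ne_finset_zero fun l hl => by rw [ha l hl, zero_mul]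
    rw [proj_apply]
    have e : ∑ l ∈ Finset.Icc (-(n : ℤ)) n, a l * expo l x
        = ∑ l ∈ Finset.Icc (-(n : ℤ)) n, ip u (expo l) * expo l x :=
      Finset.sum_congr rfl fun l hl => by simp only [a, if_pos hl]
    rwa [e] at h
  rw [ip_expo_of_hasSum_expo hsum hs]
  exact if_pos hl

/-- Nikolskii's inequality between the uniform and the `L²` norm. -/
theorem sq_norm_apply_le_of_mem_trigSpace (hv : v ∈ trigSpace n) (x : ℝ) :
    ‖v x‖ ^ 2 ≤ (2 * n + 1) * ∫ x in (0 : ℝ)..1, ‖v x‖ ^ 2 := by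
  obtain ⟨h1, h2, -⟩ := trigSpace_spec hv
  rw [h2, ← card_Icc_neg]
  have h3 : ‖v x‖ ≤ ∑ l ∈ Finset.Icc (-(n : ℤ)) n, ‖ip v (expo l)‖ := by
    rw [h1 x]
    refine (norm_sum_le _ _).trans_eq (Finset.sum_congr rfl fun l _ => ?_)
    rw [norm_mul, norm_expo, mul_one]
  calc ‖v x‖ ^ 2 ≤ (∑ l ∈ Finset.Icc (-(n : ℤ)) n, ‖ip v (expo l)‖) ^ 2 := by gcongr
    _ ≤ _ := sq_sum_le_card_mul_sum_sq

end Trig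

theorem ip_sub {g h k : ℝ → ℂ} (hg : Continuous g) (hh : Continuous h) (hk : Continuous k) :
    ip (fun x => g x - h x) k = ip g k - ip h k := by
  change ip (g - h) k = _
  rw [eq_sub_iff_add_eq, ← ip_add (hg.sub hh) hh hk, sub_add_cancel]

theorem ip_partialFrame (lam : ℤ → ℝ) (m : ℕ) (g : ℝ → ℂ) {k : ℝ → ℂ} (hk : Continuous k) :
    ip (partialFrame lam m g) k
      = ∑ j ∈ Finset.Icc (-(m : ℤ)) m, ip g (expo (lam j)) * ip (expo (lam j)) k := by
  have hk' : Continuous fun x => (starRingEnd ℂ) (k x) := Complex.continuous_conj.comp hk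
  unfold partialFrame
  conv_lhs => rw [ip]
  simp only [Finset.sum_apply, Pi.smul_apply, Finset.sum_mul, smul_eq_mul]
  rw [intervalIntegral.integral_finsetSum]
  · refine Finset.sum_congr rfl fun j _ => ?_
    rw [show ip (expo (lam j)) k
      = ∫ x in (0 : ℝ)..1, expo (lam j) x * (starRingEnd ℂ) (k x) from rfl,
      ← intervalIntegral.integral_const_mul]
    simp only [mul_assoc]
  · intro j _
    exact ((continuous_const.mul (expo_continuous _)).mul hk').intervalIntegrable _ _

/-! ### Stability of the truncated frame operator -/

section Stability

variable {lam : ℤ → ℝ} {A B c₀ : ℝ}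

/-- The arithmetic behind the choice of `n`: with `Y = π c₀ / 2 ≥ 1` the claim reduces to
`8 / π² ≤ 8 Y² / π² + 1 - Y`, with equality at `Y = 1`. -/
theorem modes_numerics {A c₀ Y m n : ℝ} (hA1 : A ≤ 1) (hY : Y = Real.pi * c₀ / 2)
    (hY1 : 1 ≤ Y) (hn : 1 ≤ n) (hnm : n * (A + 2 * c₀ ^ 2) ≤ A * m) :
    8 * n / Real.pi ^ 2 ≤ A * (m - n + 1 - Y) := by
  have hpi := Real.pi_gt_three
  have hpi4 := Real.pi_lt_four
  have hc : 2 * c₀ ^ 2 = 8 / Real.pi ^ 2 * Y ^ 2 := by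
    rw [hY]; field_simp; ring
  have h1 : 8 / Real.pi ^ 2 ≤ 8 / Real.pi ^ 2 * Y ^ 2 + 1 - Y := by
    have h2 : 1 / 2 ≤ 8 / Real.pi ^ 2 := by
      rw [div_le_div_iff₀ two_pos (by positivity)]; nlinarith
    nlinarith [mul_nonneg (sub_nonneg.2 h2) (mul_nonneg (sub_nonneg.2 hY1)
      (by linarith : 0 ≤ Y + 1)), sq_nonneg (Y - 1)]
  have h3 : n * (1 - Y) ≤ A * (1 - Y) := by nlinarith
  have h4 : 2 * c₀ ^ 2 * n ≤ A * (m - n) := by nlinarith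
  calc 8 * n / Real.pi ^ 2 = n * (8 / Real.pi ^ 2) := by ring
    _ ≤ n * (8 / Real.pi ^ 2 * Y ^ 2 + 1 - Y) := by gcongr
    _ = 2 * c₀ ^ 2 * n + n * (1 - Y) := by rw [hc]; ring
    _ ≤ A * (m - n) + A * (1 - Y) := add_le_add h4 h3
    _ = _ := by ring

theorem modes_mul_le (hA : 0 < A) (c₀ : ℝ) (m : ℕ) :
    (modes A c₀ m : ℝ) * (A + 2 * c₀ ^ 2) ≤ A * m := by
  have h0 : 0 < A + 2 * c₀ ^ 2 := by positivity
  have h1 : (modes A c₀ m : ℝ) ≤ modeBound A c₀ m :=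
    Nat.floor_le (by unfold modeBound; positivity)
  rw [modeBound, le_div_iff₀ h0] at h1
  exact h1

/-- The first `2m + 1` frame elements already see a quarter of the energy of every trigonometric
polynomial of degree `n`. The tail is estimated from the explicit size `|sin πt| / (π|t|)` of the
coefficients at `t = λ_j - l` together with `|λ_j - j| ≤ π c₀ / 2 - 1/2`. -/
theorem quarter_energy_le (hF : IsFourierFrame lam A B) (ha : IsAdmissible lam c₀) {m : ℕ}
    (hn : 1 ≤ modes A c₀ m) {v : ℝ → ℂ} (hv : v ∈ trigSpace (modes A c₀ m)) :
    A / 4 * ∫ x in (0 : ℝ)..1, ‖v x‖ ^ 2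
      ≤ ∑ j ∈ Finset.Icc (-(m : ℤ)) m, ‖ip v (expo (lam j))‖ ^ 2 := by
  have hA := hF.1
  have hA1 := hF.le_one ha
  have hpi := Real.pi_pos
  set n := modes A c₀ m with hndef
  have hn1 : (1 : ℝ) ≤ n := by exact_mod_cast hn
  obtain ⟨-, hY1⟩ := ha.abs_sub_le 0
  have hnum := modes_numerics (m := m) hA1 rfl hY1 hn1 (modes_mul_le hA c₀ m)
  set Y := Real.pi * c₀ / 2 with hY
  have hpos : 0 < (m : ℝ) - n + 1 - Y := by
    have : 0 < A * ((m : ℝ) - n + 1 - Y) := lt_of_lt_of_le (by positivity) hnum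
    exact pos_of_mul_pos_right this hA.le
  obtain ⟨-, hE, hip⟩ := trigSpace_spec hv
  set E := ∫ x in (0 : ℝ)..1, ‖v x‖ ^ 2 with hEdef
  have hE0 : 0 ≤ E := by rw [hE]; positivity
  obtain ⟨hs, h1, -⟩ := hF.2.2 v (memLp_of_continuous (continuous_of_mem_trigSpace hv))
  have h2 := tsum_le_sum_Icc_add (m := m) (c := (2 * n + 1) / Real.pi ^ 2 * E)
    (y := n + (Y - 1 / 2)) hs (by positivity) (by linarith) (by
      intro j hj
      have hj' : (m : ℝ) + 1 ≤ j.natAbs := by exact_mod_cast hj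
      have hgap : 0 < (j.natAbs : ℝ) - (n + (Y - 1 / 2)) := by linarith
      have hterm : ∀ l ∈ Finset.Icc (-(n : ℤ)) n, ‖ip (expo l) (expo (lam j))‖ ^ 2
          ≤ 1 / Real.pi ^ 2 * (1 / ((j.natAbs : ℝ) - (n + (Y - 1 / 2))) ^ 2) := by
        intro l hl
        rw [mem_Icc_iff_natAbs] at hl
        have e1 : (j.natAbs : ℝ) = |(j : ℝ)| := by rw [Nat.cast_natAbs, Int.cast_abs]
        have e2 : |(l : ℝ)| ≤ n := by
          rw [← Int.cast_abs, ← Nat.cast_natAbs]; exact_mod_cast hl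
        have e3 := abs_sub_abs_le_abs_sub (j : ℝ) l
        have e4 := _root_.abs_sub_le (j : ℝ) (lam j) l
        have e5 := (ha.abs_sub_le j).1
        rw [abs_sub_comm] at e5
        have e6 : (j.natAbs : ℝ) - (n + (Y - 1 / 2)) ≤ |lam j - l| := by
          rw [e1]; linarith
        have hne : lam j - l ≠ 0 := abs_pos.1 (hgap.trans_le e6)
        have e7 := norm_integral_expo_le _ hne
        rw [norm_ip_comm, ip_expo_expo]
        calc ‖∫ x in (0 : ℝ)..1, expo (lam j - l) x‖ ^ 2 ≤ (1 / (Real.pi * |lam j - l|)) ^ 2 := by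
              gcongr
          _ ≤ (1 / (Real.pi * ((j.natAbs : ℝ) - (n + (Y - 1 / 2))))) ^ 2 := by gcongr
          _ = _ := by rw [div_pow, mul_pow]; field_simp
      have hsum := Finset.sum_le_card_nsmul _ _ _ hterm
      rw [nsmul_eq_mul, card_Icc_neg] at hsum
      rw [hip (lam j)]
      have hcs : ‖∑ l ∈ Finset.Icc (-(n : ℤ)) n, ip v (expo l) * ip (expo l) (expo (lam j))‖
          ≤ ∑ l ∈ Finset.Icc (-(n : ℤ)) n, ‖ip v (expo l)‖ * ‖ip (expo l) (expo (lam j))‖ := by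
        refine (norm_sum_le _ _).trans_eq (Finset.sum_congr rfl fun l _ => norm_mul _ _)
      calc _ ≤ (∑ l ∈ Finset.Icc (-(n : ℤ)) n,
              ‖ip v (expo l)‖ * ‖ip (expo l) (expo (lam j))‖) ^ 2 := by gcongr
        _ ≤ (∑ l ∈ Finset.Icc (-(n : ℤ)) n, ‖ip v (expo l)‖ ^ 2)
            * ∑ l ∈ Finset.Icc (-(n : ℤ)) n, ‖ip (expo l) (expo (lam j))‖ ^ 2 :=
          Finset.sum_mul_sq_le_sq_mul_sq _ _ _
        _ ≤ E * ((2 * n + 1) * (1 / Real.pi ^ 2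
            * (1 / ((j.natAbs : ℝ) - (n + (Y - 1 / 2))) ^ 2))) := by
          rw [← hE]; gcongr
        _ = _ := by ring)
  have h3 : 2 * ((2 * n + 1) / Real.pi ^ 2 * E) / ((m : ℝ) + 1 / 2 - (n + (Y - 1 / 2)))
      ≤ 3 * A / 4 * E := by
    rw [show (m : ℝ) + 1 / 2 - (n + (Y - 1 / 2)) = m - n + 1 - Y by ring, div_le_iff₀ hpos]
    have h4 : 2 * (2 * (n : ℝ) + 1) / Real.pi ^ 2 ≤ 3 / 4 * (8 * n / Real.pi ^ 2) := by
      rw [mul_div_assoc', div_le_div_iff_of_pos_right (by positivity)]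
      linarith
    calc 2 * ((2 * (n : ℝ) + 1) / Real.pi ^ 2 * E) = 2 * (2 * (n : ℝ) + 1) / Real.pi ^ 2 * E := by
          ring
      _ ≤ 3 / 4 * (A * ((m : ℝ) - n + 1 - Y)) * E := by gcongr; linarith
      _ = _ := by ring
  linarith

/-- Energy estimate for the normal equations: if `w` solves the least squares problem with data
`⟨k, ψ_j⟩`, its samples are no larger than the data. -/
theorem sum_sq_ip_le_of_normal_equations {m n : ℕ} {w k : ℝ → ℂ} (hw : w ∈ trigSpace n)
    (h : ∀ l ∈ Finset.Icc (-(n : ℤ)) n,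
      ∑ j ∈ Finset.Icc (-(m : ℤ)) m, ip w (expo (lam j)) * ip (expo (lam j)) (expo l)
        = ∑ j ∈ Finset.Icc (-(m : ℤ)) m, ip k (expo (lam j)) * ip (expo (lam j)) (expo l)) :
    ∑ j ∈ Finset.Icc (-(m : ℤ)) m, ‖ip w (expo (lam j))‖ ^ 2
      ≤ ∑ j ∈ Finset.Icc (-(m : ℤ)) m, ‖ip k (expo (lam j))‖ ^ 2 := by
  obtain ⟨-, -, hip⟩ := trigSpace_spec hw
  have hconj : ∀ u : ℤ → ℂ, ∑ l ∈ Finset.Icc (-(n : ℤ)) n, (∑ j ∈ Finset.Icc (-(m : ℤ)) m,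
      u j * ip (expo (lam j)) (expo l)) * (starRingEnd ℂ) (ip w (expo l))
      = ∑ j ∈ Finset.Icc (-(m : ℤ)) m, u j * (starRingEnd ℂ) (ip w (expo (lam j))) := by
    intro u
    simp only [Finset.sum_mul]
    rw [Finset.sum_comm]
    refine Finset.sum_congr rfl fun j _ => ?_
    rw [hip (lam j), map_sum, Finset.mul_sum]
    refine Finset.sum_congr rfl fun l _ => ?_
    rw [map_mul, conj_ip (expo l)]
    ring
  have h1 : ∑ j ∈ Finset.Icc (-(m : ℤ)) m,
      ip w (expo (lam j)) * (starRingEnd ℂ) (ip w (expo (lam j)))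
      = ∑ j ∈ Finset.Icc (-(m : ℤ)) m,
        ip k (expo (lam j)) * (starRingEnd ℂ) (ip w (expo (lam j))) := by
    rw [← hconj, ← hconj]
    exact Finset.sum_congr rfl fun l hl => by rw [h l hl]
  set S := ∑ j ∈ Finset.Icc (-(m : ℤ)) m, ‖ip w (expo (lam j))‖ ^ 2 with hS
  set T := ∑ j ∈ Finset.Icc (-(m : ℤ)) m, ‖ip k (expo (lam j))‖ ^ 2
  have hS0 : 0 ≤ S := by positivity
  have h2 : S ≤ ∑ j ∈ Finset.Icc (-(m : ℤ)) m, ‖ip k (expo (lam j))‖ * ‖ip w (expo (lam j))‖ := by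
    have e : ((S : ℝ) : ℂ) = ∑ j ∈ Finset.Icc (-(m : ℤ)) m,
        ip w (expo (lam j)) * (starRingEnd ℂ) (ip w (expo (lam j))) := by
      rw [hS, Complex.ofReal_sum]
      refine Finset.sum_congr rfl fun j _ => ?_
      rw [Complex.mul_conj, Complex.normSq_eq_norm_sq]
    have : S = ‖((S : ℝ) : ℂ)‖ := by rw [Complex.norm_real, Real.norm_of_nonneg hS0]
    rw [this, e, h1]
    refine (norm_sum_le _ _).trans_eq (Finset.sum_congr rfl fun j _ => ?_)
    rw [norm_mul, RCLike.norm_conj]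
  have h3 : S ^ 2 ≤ T * S :=
    calc S ^ 2 ≤ (∑ j ∈ Finset.Icc (-(m : ℤ)) m,
          ‖ip k (expo (lam j))‖ * ‖ip w (expo (lam j))‖) ^ 2 := by gcongr
      _ ≤ _ := Finset.sum_mul_sq_le_sq_mul_sq _ _ _
  rcases hS0.eq_or_lt with h0 | h0
  · rw [← h0]; positivity
  · rw [pow_two] at h3
    exact le_of_mul_le_mul_right h3 h0

theorem integral_sq_le_of_normal_equations (hF : IsFourierFrame lam A B)
    (ha : IsAdmissible lam c₀) {m : ℕ} (hn : 1 ≤ modes A c₀ m) {w k : ℝ → ℂ}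
    (hw : w ∈ trigSpace (modes A c₀ m)) (hk : Continuous k)
    (h : ∀ l ∈ Finset.Icc (-(modes A c₀ m : ℤ)) (modes A c₀ m),
      ∑ j ∈ Finset.Icc (-(m : ℤ)) m, ip w (expo (lam j)) * ip (expo (lam j)) (expo l)
        = ∑ j ∈ Finset.Icc (-(m : ℤ)) m, ip k (expo (lam j)) * ip (expo (lam j)) (expo l)) :
    ∫ x in (0 : ℝ)..1, ‖w x‖ ^ 2 ≤ 4 * B / A * ∫ x in (0 : ℝ)..1, ‖k x‖ ^ 2 := by
  have hA := hF.1
  have h1 := quarter_energy_le hF ha hn hw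
  have h2 := sum_sq_ip_le_of_normal_equations hw h
  obtain ⟨hs, -, h3⟩ := hF.2.2 k (memLp_of_continuous hk)
  have h4 := hs.sum_le_tsum (Finset.Icc (-(m : ℤ)) m) (fun j _ => sq_nonneg _)
  rw [div_mul_eq_mul_div, le_div_iff₀ hA]
  linarith

theorem isUnit_frameOp (hF : IsFourierFrame lam A B) (ha : IsAdmissible lam c₀) {m : ℕ}
    (hn : 1 ≤ modes A c₀ m) : IsUnit (frameOp lam m (modes A c₀ m)) := by
  set n := modes A c₀ m
  have hfin : FiniteDimensional ℂ (trigSpace n) :=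
    FiniteDimensional.span_of_finite ℂ ((Set.finite_Icc _ _).image _)
  rw [LinearMap.isUnit_iff_ker_eq_bot, LinearMap.ker_eq_bot']
  intro w hw
  have h := integral_sq_le_of_normal_equations (lam := lam) (w := (w : ℝ → ℂ)) (k := 0) hF ha hn
    w.2 continuous_const (by
      intro l hl
      have e0 : ∀ t, ip (0 : ℝ → ℂ) (expo t) = 0 := fun t => by simp [ip]
      have e1 : ip (frameOp lam m n w : ℝ → ℂ) (expo l) = 0 := by
        rw [hw]; exact e0 _
      change ip (proj n (partialFrame lam m w) : ℝ → ℂ) (expo l) = 0 at e1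
      rw [ip_proj _ hl, ip_partialFrame _ _ _ (expo_continuous _)] at e1
      simp only [e0, zero_mul, Finset.sum_const_zero]
      exact e1)
  have h0 : 4 * B / A * ∫ x in (0 : ℝ)..1, ‖(0 : ℝ → ℂ) x‖ ^ 2 = 0 := by simp
  rw [h0] at h
  apply Subtype.ext
  funext x
  have h1 := sq_norm_apply_le_of_mem_trigSpace w.2 x
  have h2 : ‖(w : ℝ → ℂ) x‖ ^ 2 ≤ 0 := h1.trans (mul_nonpos_of_nonneg_of_nonpos (by positivity) h)
  have h3 : ‖(w : ℝ → ℂ) x‖ = 0 := pow_eq_zero_iff two_ne_zero |>.1 (le_antisymm h2 (by positivity))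
  simpa using h3

/-- Quasi-optimality: the reconstruction of a continuous `h` differs from `Q_n h` by the solution
of the normal equations with data `h - Q_n h`. -/
theorem norm_sub_recon_le (hF : IsFourierFrame lam A B) (ha : IsAdmissible lam c₀) {m : ℕ}
    (hn : 1 ≤ modes A c₀ m) {h : ℝ → ℂ} (hh : Continuous h) (x : ℝ) :
    ‖h x - (Ring.inverse (frameOp lam m (modes A c₀ m))
        (proj (modes A c₀ m) (partialFrame lam m h)) : ℝ → ℂ) x‖
      ≤ ‖h x - (proj (modes A c₀ m) h : ℝ → ℂ) x‖
        + √((2 * modes A c₀ m + 1) * (4 * B / A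
          * ∫ x in (0 : ℝ)..1, ‖h x - (proj (modes A c₀ m) h : ℝ → ℂ) x‖ ^ 2)) := by
  have hU := isUnit_frameOp hF ha hn
  set n := modes A c₀ m
  set v := Ring.inverse (frameOp lam m n) (proj n (partialFrame lam m h)) with hv
  have hWv : frameOp lam m n v = proj n (partialFrame lam m h) := by
    rw [hv, ← Module.End.mul_apply, Ring.mul_inverse_cancel _ hU, Module.End.one_apply]
  set Q := proj n h
  have hQc : Continuous (Q : ℝ → ℂ) := continuous_of_mem_trigSpace Q.2
  have hvc : Continuous (v : ℝ → ℂ) := continuous_of_mem_trigSpace v.2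
  have hkc : Continuous fun x => h x - (Q : ℝ → ℂ) x := hh.sub hQc
  have hw : (fun x => (v : ℝ → ℂ) x - (Q : ℝ → ℂ) x) ∈ trigSpace n := (v - Q).2
  have hI := integral_sq_le_of_normal_equations hF ha hn hw hkc (by
    intro l hl
    have e1 : ip (frameOp lam m n v : ℝ → ℂ) (expo l)
        = ip (proj n (partialFrame lam m h) : ℝ → ℂ) (expo l) := by rw [hWv]
    change ip (proj n (partialFrame lam m v) : ℝ → ℂ) (expo l) = _ at e1
    rw [ip_proj _ hl, ip_proj _ hl, ip_partialFrame _ _ _ (expo_continuous _),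
      ip_partialFrame _ _ _ (expo_continuous _)] at e1
    simp only [ip_sub hvc hQc (expo_continuous _), ip_sub hh hQc (expo_continuous _), sub_mul,
      Finset.sum_sub_distrib]
    rw [e1])
  have hx := sq_norm_apply_le_of_mem_trigSpace hw x
  have hx2 : ‖(v : ℝ → ℂ) x - (Q : ℝ → ℂ) x‖ ≤ √((2 * n + 1) * (4 * B / A
      * ∫ x in (0 : ℝ)..1, ‖h x - (Q : ℝ → ℂ) x‖ ^ 2)) := by
    refine Real.le_sqrt_of_sq_le (hx.trans ?_)
    gcongr
  calc ‖h x - (v : ℝ → ℂ) x‖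
      = ‖(h x - (Q : ℝ → ℂ) x) - ((v : ℝ → ℂ) x - (Q : ℝ → ℂ) x)‖ := by congr 1; ring
    _ ≤ ‖h x - (Q : ℝ → ℂ) x‖ + ‖(v : ℝ → ℂ) x - (Q : ℝ → ℂ) x‖ := norm_sub_le _ _
    _ ≤ _ := by gcongr

end Stability

/-! ### Tails of the filtered Fourier series -/

/-- Chernoff's bound: `σ_p(w)` is the probability that a Poisson variable of mean `w²/2 = P v` is at
most `p ≤ P`. -/
theorem hdafFilter_le_chernoff {p : ℕ} {P v w : ℝ} (hP : 0 ≤ P) (hp : (p : ℝ) ≤ P) (hv : 1 ≤ v)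
    (hw : w ^ 2 / 2 = P * v) :
    hdafFilter p w ≤ Real.exp (-(P * (v - 1 - Real.log v))) := by
  unfold hdafFilter
  rw [hw]
  have h1 : ∑ l ∈ Finset.range (p + 1), (P * v) ^ l / (l.factorial : ℝ)
      ≤ Real.exp (P * Real.log v) * Real.exp P := by
    have h2 := Real.sum_le_exp_of_nonneg hP (p + 1)
    have h3 : v ^ p ≤ Real.exp (P * Real.log v) := by
      rw [← Real.rpow_natCast, Real.rpow_def_of_pos (by linarith), mul_comm]
      exact Real.exp_le_exp.2 (mul_le_mul_of_nonneg_right hp (Real.log_nonneg hv))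
    calc ∑ l ∈ Finset.range (p + 1), (P * v) ^ l / (l.factorial : ℝ)
        ≤ ∑ l ∈ Finset.range (p + 1), v ^ p * (P ^ l / (l.factorial : ℝ)) := by
          refine Finset.sum_le_sum fun l hl => ?_
          rw [mul_pow, mul_comm (P ^ l), mul_div_assoc]
          gcongr
          exact Nat.lt_succ_iff.1 (Finset.mem_range.1 hl)
      _ = v ^ p * ∑ l ∈ Finset.range (p + 1), P ^ l / (l.factorial : ℝ) := by
          rw [Finset.mul_sum]
      _ ≤ _ := by gcongr
  calc _ ≤ Real.exp (-(P * v)) * (Real.exp (P * Real.log v) * Real.exp P) := by gcongr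
    _ = _ := by rw [← Real.exp_add, ← Real.exp_add]; congr 1; ring

/-- Beyond the cut-off `L` the filter has, on top of the Chernoff factor, Gaussian decay. -/
theorem hdafFilter_le_gaussian {p : ℕ} {P θ y w : ℝ} (hP : 0 ≤ P) (hp : (p : ℝ) ≤ P)
    (hθ : 1 ≤ θ) (hy : 1 ≤ y) (hw : w ^ 2 / 2 = P * (θ * y ^ 2)) :
    hdafFilter p w
      ≤ Real.exp (-(P * (θ - 1 - Real.log θ))) * Real.exp (-(P * (y - 1) ^ 2)) := by
  refine (hdafFilter_le_chernoff hP hp (one_le_mul_of_one_le_of_one_le hθ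
    (one_le_pow₀ hy)) hw).trans ?_
  rw [← Real.exp_add]
  refine Real.exp_le_exp.2 ?_
  have h1 := Real.log_le_sub_one_of_pos (by linarith : 0 < y)
  rw [Real.log_mul (by positivity) (by positivity), Real.log_pow]
  have h2 : (θ - 1 - Real.log θ) + (y - 1) ^ 2
      ≤ θ * y ^ 2 - 1 - (Real.log θ + (2 : ℕ) * Real.log y) := by
    push_cast
    nlinarith [mul_nonneg (sub_nonneg.2 hθ) (by nlinarith : 0 ≤ y ^ 2 - 1)]
  nlinarith [mul_le_mul_of_nonneg_left h2 hP]

theorem sum_exp_neg_mul_sq_le {c : ℝ} (hc : 0 < c) (J : ℕ) :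
    ∑ i ∈ Finset.range J, Real.exp (-c * (i : ℝ) ^ 2) ≤ 1 + √(Real.pi / c) / 2 := by
  rcases J with _ | J
  · simp only [Finset.range_zero, Finset.sum_empty]; positivity
  · rw [Finset.sum_range_succ', add_comm]
    have h0 : Real.exp (-c * ((0 : ℕ) : ℝ) ^ 2) = 1 := by simp
    rw [h0]
    refine add_le_add le_rfl ?_
    have hanti : AntitoneOn (fun x : ℝ => Real.exp (-c * x ^ 2)) (Set.Icc 0 (0 + (J : ℝ))) := by
      intro a ha b hb hab
      have : a ^ 2 ≤ b ^ 2 := pow_le_pow_left₀ ha.1 hab 2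
      exact Real.exp_le_exp.2 (by nlinarith)
    have h1 := hanti.sum_le_integral
    simp only [zero_add] at h1
    refine h1.trans ?_
    rw [← integral_gaussian_Ioi, intervalIntegral.integral_of_le (by positivity)]
    exact setIntegral_mono_set (integrable_exp_neg_mul_sq hc).integrableOn
      (Filter.Eventually.of_forall fun x => (Real.exp_pos _).le)
      (Filter.Eventually.of_forall fun x hx => hx.1)

/-- The remainder of an absolutely convergent Fourier series after its symmetric partial sum. -/
theorem hasSum_sub_proj {a : ℤ → ℂ} {h : ℝ → ℂ} (ha : Summable fun l => ‖a l‖)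
    (hs : ∀ x, HasSum (fun l : ℤ => a l * expo l x) (h x)) (n : ℕ) (x : ℝ) :
    HasSum (fun l : ℤ => (if n < l.natAbs then a l else 0) * expo l x)
      (h x - (proj n h : ℝ → ℂ) x) := by
  have h1 : HasSum (fun l : ℤ => (if n < l.natAbs then 0 else a l) * expo l x)
      (∑ l ∈ Finset.Icc (-(n : ℤ)) n, (if n < l.natAbs then 0 else a l) * expo l x) :=
    hasSum_sum_of_ne_finset_zero fun l hl => by
      rw [mem_Icc_iff_natAbs, not_le] at hl
      rw [if_pos hl, zero_mul]
  have e : (proj n h : ℝ → ℂ) x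
      = ∑ l ∈ Finset.Icc (-(n : ℤ)) n, (if n < l.natAbs then 0 else a l) * expo l x := by
    rw [proj_apply]
    refine Finset.sum_congr rfl fun l hl => ?_
    rw [mem_Icc_iff_natAbs] at hl
    rw [ip_expo_of_hasSum_expo ha hs, if_neg (by omega)]
  rw [e]
  convert! (hs x).sub h1 using 2 with l
  split_ifs <;> ring

section Tail

variable {f : ℝ → ℂ} {h : ℝ → ℂ} {σ : ℤ → ℝ} {n : ℕ} {L P E S : ℝ}

theorem integral_sq_sub_proj_le (hf : MemLp f 2 (volume.restrict (Set.Ioc (0 : ℝ) 1)))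
    (hσ0 : ∀ l, 0 ≤ σ l) (hσs : Summable fun l => ‖(σ l : ℂ) * ip f (expo l)‖)
    (hs : ∀ x, HasSum (fun l : ℤ => (σ l : ℂ) * ip f (expo l) * expo l x) (h x))
    (hfS : ∫ x in (0 : ℝ)..1, ‖f x‖ ^ 2 ≤ S ^ 2) (hσ : ∀ l : ℤ, n < l.natAbs → σ l ≤ E) :
    ∫ x in (0 : ℝ)..1, ‖h x - (proj n h : ℝ → ℂ) x‖ ^ 2 ≤ (E * S) ^ 2 := by
  have hk := hasSum_sub_proj hσs hs n
  have hks : Summable fun l : ℤ => ‖if n < l.natAbs then (σ l : ℂ) * ip f (expo l) else 0‖ :=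
    Summable.of_nonneg_of_le (fun _ => norm_nonneg _) (fun l => by
      split_ifs
      · exact le_rfl
      · rw [norm_zero]; positivity) hσs
  have h1 := integral_sq_of_hasSum_expo hks hk
  have h2 := (hasSum_sq_ip hf).mul_left (E ^ 2)
  refine (hasSum_le (fun l => ?_) h1 h2).trans ?_
  · split_ifs with hl
    · rw [norm_mul, mul_pow, Complex.norm_real, Real.norm_of_nonneg (hσ0 l)]
      have := hσ l hl
      have := hσ0 l
      gcongr
    · rw [norm_zero, zero_pow two_ne_zero]; positivity
  · rw [mul_pow]
    gcongr

/-- The uniform norm of the Fourier tail, by Cauchy–Schwarz and comparison of the squared filter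
with a Gaussian integral. -/
theorem norm_sub_proj_le (hf : MemLp f 2 (volume.restrict (Set.Ioc (0 : ℝ) 1)))
    (hσ0 : ∀ l, 0 ≤ σ l) (hσs : Summable fun l => ‖(σ l : ℂ) * ip f (expo l)‖)
    (hs : ∀ x, HasSum (fun l : ℤ => (σ l : ℂ) * ip f (expo l) * expo l x) (h x))
    (hfS : ∫ x in (0 : ℝ)..1, ‖f x‖ ^ 2 ≤ S ^ 2) (hS : 0 ≤ S) (hE : 0 ≤ E) (hL : 0 < L)
    (hLn : L < n + 1) (hP : 0 < P)
    (hσ : ∀ l : ℤ, n < l.natAbs → σ l ≤ E * Real.exp (-(P * ((l.natAbs : ℝ) / L - 1) ^ 2)))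
    (x : ℝ) :
    ‖h x - (proj n h : ℝ → ℂ) x‖ ≤ S * E * √(2 + √(Real.pi / (2 * P / L ^ 2))) := by
  have hc : 0 < 2 * P / L ^ 2 := by positivity
  set c := 2 * P / L ^ 2 with hcdef
  refine le_of_tendsto' (hasSum_sub_proj hσs hs n x).norm fun s => ?_
  have h1 : ‖∑ l ∈ s, (if n < l.natAbs then (σ l : ℂ) * ip f (expo l) else 0) * expo l x‖
      ≤ ∑ l ∈ s with n < l.natAbs, ‖ip f (expo l)‖ * σ l := by
    rw [Finset.sum_filter]
    refine (norm_sum_le _ _).trans (Finset.sum_le_sum fun l _ => ?_)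
    rw [norm_mul, norm_expo, mul_one]
    split_ifs
    · rw [norm_mul, Complex.norm_real, Real.norm_of_nonneg (hσ0 l), mul_comm]
    · rw [norm_zero]
  refine h1.trans ?_
  have hA : ∑ l ∈ s with n < l.natAbs, ‖ip f (expo l)‖ ^ 2 ≤ S ^ 2 :=
    (sum_le_hasSum _ (fun _ _ => sq_nonneg _) (hasSum_sq_ip hf)).trans hfS
  have hB : ∑ l ∈ s with n < l.natAbs, σ l ^ 2 ≤ E ^ 2 * (2 + √(Real.pi / c)) := by
    obtain ⟨J, hJ⟩ := exists_sum_natAbs_le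
      (u := fun k : ℕ => E ^ 2 * Real.exp (-(2 * P) * ((k : ℝ) / L - 1) ^ 2))
      (fun k => by positivity) n s
    have h2 : ∑ l ∈ s with n < l.natAbs, σ l ^ 2
        ≤ ∑ l ∈ s with n < l.natAbs,
          E ^ 2 * Real.exp (-(2 * P) * ((l.natAbs : ℝ) / L - 1) ^ 2) := by
      refine Finset.sum_le_sum fun l hl => ?_
      have h3 := hσ l (Finset.mem_filter.1 hl).2
      have h4 := hσ0 l
      calc σ l ^ 2 ≤ (E * Real.exp (-(P * ((l.natAbs : ℝ) / L - 1) ^ 2))) ^ 2 := by gcongr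
        _ = _ := by
          rw [mul_pow, ← Real.exp_nat_mul]
          congr 2
          push_cast
          ring
    have h5 : ∀ i : ℕ, E ^ 2 * Real.exp (-(2 * P) * (((n + 1 + i : ℕ) : ℝ) / L - 1) ^ 2)
        ≤ E ^ 2 * Real.exp (-c * (i : ℝ) ^ 2) := by
      intro i
      refine mul_le_mul_of_nonneg_left (Real.exp_le_exp.2 ?_) (sq_nonneg E)
      have h6 : (i : ℝ) / L ≤ ((n + 1 + i : ℕ) : ℝ) / L - 1 := by
        rw [div_le_iff₀ hL, sub_mul, div_mul_cancel₀ _ hL.ne']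
        push_cast
        linarith
      have h7 : ((i : ℝ) / L) ^ 2 ≤ (((n + 1 + i : ℕ) : ℝ) / L - 1) ^ 2 := by gcongr
      have h8 : c * (i : ℝ) ^ 2 = 2 * P * ((i : ℝ) / L) ^ 2 := by rw [hcdef]; field_simp
      rw [neg_mul, neg_mul, h8]
      nlinarith
    refine h2.trans (hJ.trans ?_)
    have h9 := sum_exp_neg_mul_sq_le hc J
    calc 2 * ∑ i ∈ Finset.range J, E ^ 2
          * Real.exp (-(2 * P) * (((n + 1 + i : ℕ) : ℝ) / L - 1) ^ 2)
        ≤ 2 * ∑ i ∈ Finset.range J, E ^ 2 * Real.exp (-c * (i : ℝ) ^ 2) := by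
          have := Finset.sum_le_sum fun i (_ : i ∈ Finset.range J) => h5 i
          linarith
      _ = E ^ 2 * (2 * ∑ i ∈ Finset.range J, Real.exp (-c * (i : ℝ) ^ 2)) := by
          rw [← Finset.mul_sum]; ring
      _ ≤ E ^ 2 * (2 * (1 + √(Real.pi / c) / 2)) := by gcongr
      _ = _ := by ring
  refine (sq_le_sq₀ (Finset.sum_nonneg fun l _ => mul_nonneg (norm_nonneg _) (hσ0 l))
    (by positivity)).1 ?_
  calc (∑ l ∈ s with n < l.natAbs, ‖ip f (expo l)‖ * σ l) ^ 2
      ≤ (∑ l ∈ s with n < l.natAbs, ‖ip f (expo l)‖ ^ 2)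
        * ∑ l ∈ s with n < l.natAbs, σ l ^ 2 := Finset.sum_mul_sq_le_sq_mul_sq _ _ _
    _ ≤ S ^ 2 * (E ^ 2 * (2 + √(Real.pi / c))) := by gcongr
    _ = _ := by rw [mul_pow, mul_pow, Real.sq_sqrt (by positivity)]; ring

end Tail

/-! ### Functions with a jump -/

theorem IsPiecewiseAnalytic.memLp_top {f : ℝ → ℝ} {ξ : ℝ} (hf : IsPiecewiseAnalytic f ξ)
    (hξ : ξ ∈ Set.Ioo (0 : ℝ) 1) : MemLp f ⊤ (volume.restrict (Set.Icc (0 : ℝ) 1)) := by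
  obtain ⟨g, hg, hg1, hg2⟩ := hf
  obtain ⟨M, hM⟩ := isCompact_Icc.exists_bound_of_continuousOn hg.continuousOn
  have h1 : MemLp (periodicExt g ξ) ⊤ (volume.restrict (Set.Icc (0 : ℝ) 1)) :=
    memLp_top_of_bound (measurable_periodicExt hg.continuousOn).aestronglyMeasurable M
      (Filter.Eventually.of_forall fun y => hM _ (add_fract_mem_Icc ξ _))
  refine (memLp_congr_ae ?_).1 h1
  have h2 : ∀ᵐ y : ℝ, y ≠ ξ := compl_mem_ae_iff.2 (measure_singleton ξ)
  rw [Filter.EventuallyEq, ae_restrict_iff' measurableSet_Icc]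
  filter_upwards [h2] with y hy hy1
  exact (eq_periodicExt hξ hg1 hg2 hy1 hy).symm

theorem integral_sq_le_supNorm {f : ℝ → ℝ}
    (hf : MemLp f ⊤ (volume.restrict (Set.Icc (0 : ℝ) 1))) :
    ∫ x in (0 : ℝ)..1, ‖(f x : ℂ)‖ ^ 2 ≤ supNorm f ^ 2 := by
  have h1 : ∀ᵐ x ∂(volume.restrict (Set.Icc (0 : ℝ) 1)), ‖f x‖ ≤ supNorm f := by
    have h := ae_le_eLpNormEssSup (f := f) (μ := volume.restrict (Set.Icc (0 : ℝ) 1))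
    filter_upwards [h] with x hx
    rw [← eLpNorm_exponent_top] at hx
    have := ENNReal.toReal_mono hf.2.ne hx
    simpa [supNorm] using this
  have h2 := ae_restrict_of_ae_restrict_of_subset
    (Set.Ioc_subset_Icc_self (a := (0 : ℝ)) (b := 1)) h1
  rw [intervalIntegral.integral_of_le zero_le_one]
  have h3 : ∫ _x in Set.Ioc (0 : ℝ) 1, supNorm f ^ 2 = supNorm f ^ 2 := by simp
  rw [← h3]
  refine integral_mono_of_nonneg (Filter.Eventually.of_forall fun x => by positivity)
    (integrable_const _) ?_
  filter_upwards [h2] with x hx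
  rw [Complex.norm_real]
  gcongr

/-! ### Numerical comparisons -/

theorem seven_eighths_le_log : 7 / 8 ≤ Real.log (1 + √2) := by
  have h2 : (1.414 : ℝ) ≤ √2 := Real.le_sqrt_of_sq_le (by norm_num)
  have h1 : Real.exp 7 ≤ (1 + √2) ^ 8 := by
    have he := Real.exp_one_lt_d9
    calc Real.exp 7 = Real.exp 1 ^ 7 := by rw [← Real.exp_nat_mul]; norm_num
      _ ≤ 2.7182818286 ^ 7 := by gcongr
      _ ≤ (1 + 1.414) ^ 8 := by norm_num
      _ ≤ _ := by gcongr
  have h3 := Real.log_le_log (Real.exp_pos 7) h1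
  rw [Real.log_exp, Real.log_pow] at h3
  push_cast at h3
  linarith

/-- The two conditions on `α` and `κ` multiply to `κ² ≤ 2 r² / 7`, and `d ≤ 1/2`. -/
theorem order_sq_le {α κ d m r : ℝ} (hα : 0 < α) (hκ : 0 < κ) (hd : 0 ≤ d) (hd1 : d ≤ 1 / 2)
    (hακ : α * κ ≤ 4 / 7) (hr : κ / α ≤ r ^ 2 / 2) : 14 * (κ * d * m) ^ 2 ≤ (r * m) ^ 2 := by
  have h1 : κ ^ 2 ≤ 4 / 7 * (r ^ 2 / 2) := by
    calc κ ^ 2 = (α * κ) * (κ / α) := by field_simp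
      _ ≤ _ := by gcongr
  have h2 : d ^ 2 ≤ 1 / 4 := by nlinarith
  have h3 : κ ^ 2 * d ^ 2 ≤ 4 / 7 * (r ^ 2 / 2) * (1 / 4) := by gcongr
  nlinarith [mul_le_mul_of_nonneg_right h3 (sq_nonneg m)]

/-- As long as `P ≤ L / √14`, both parts of the truncation error fit under the
single factor `(2L + 1) / √(2πP)`. -/
theorem sqrt_bounds {L P : ℝ} (hL : 1 ≤ L) (hP : 0 < P) (hPL : 14 * P ^ 2 ≤ L ^ 2) :
    √(2 + √(Real.pi / (2 * P / L ^ 2))) ≤ (2 * L + 1) / √(2 * Real.pi * P) ∧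
      √(2 * L + 1) ≤ (2 * L + 1) / √(2 * Real.pi * P) := by
  have hpi := Real.pi_pos
  have hpi' := Real.pi_lt_d4
  have hPL' : P ≤ 0.2673 * L := by
    refine (sq_le_sq₀ hP.le (by positivity)).1 ?_
    nlinarith
  set q := √(2 * Real.pi * P) with hq
  have hq0 : 0 < q := Real.sqrt_pos.2 (by positivity)
  have hq2 : q ^ 2 = 2 * Real.pi * P := Real.sq_sqrt (by positivity)
  have hqL : q ^ 2 ≤ 1.68 * L := by rw [hq2]; nlinarith
  have e : √(Real.pi / (2 * P / L ^ 2)) = L * Real.pi / q := by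
    rw [Real.sqrt_eq_iff_mul_self_eq (by positivity) (by positivity)]
    have : L * Real.pi / q * (L * Real.pi / q) = L ^ 2 * Real.pi ^ 2 / q ^ 2 := by ring
    rw [this, hq2]
    field_simp
  constructor
  · rw [e]
    refine Real.sqrt_le_iff.2 ⟨by positivity, ?_⟩
    rw [div_pow, le_div_iff₀ (by positivity)]
    have h1 : (2 + L * Real.pi / q) * q ^ 2 = 2 * q ^ 2 + Real.pi * (L * q) := by
      field_simp
    rw [h1]
    -- the weight balances the terms `L²` and `L` after the arithmetic-geometric mean inequality
    have h2 : q ≤ (1.467 * q ^ 2 + 0.682) / 2 := by nlinarith [sq_nonneg (q - 0.6818)]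
    have h3 : q ≤ (1.467 * (1.68 * L) + 0.682) / 2 := by linarith
    have h4 : Real.pi * (L * q) ≤ 3.1416 * (L * ((1.467 * (1.68 * L) + 0.682) / 2)) := by
      gcongr
    nlinarith [sq_nonneg (L - 1.7)]
  · rw [Real.sqrt_le_iff]
    refine ⟨by positivity, ?_⟩
    rw [div_pow, le_div_iff₀ (by positivity)]
    have h1 : q ^ 2 ≤ 2 * L + 1 := by linarith
    nlinarith

/-- Here `Z` stands for `(2L + 1) / √(2πP)`. As `A ≤ B`, the stability constant `2 √(B/A)` is
at most `2B/A`. -/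
theorem truncation_bound {A B L P n S E Z : ℝ} (hA : 0 < A) (hAB : A ≤ B) (hn : n ≤ L)
    (hS : 0 ≤ S) (hE : 0 ≤ E) (hn0 : 0 ≤ n)
    (h1 : √(2 + √(Real.pi / (2 * P / L ^ 2))) ≤ Z) (h2 : √(2 * L + 1) ≤ Z) :
    S * E * √(2 + √(Real.pi / (2 * P / L ^ 2))) + √((2 * n + 1) * (4 * B / A * (E * S) ^ 2))
      ≤ S * ((A + 2 * B) / A * Z) * E := by
  have hB : 0 < B := hA.trans_le hAB
  have hBA : 1 ≤ B / A := (one_le_div hA).2 hAB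
  have h3 : √((2 * n + 1) * (4 * B / A * (E * S) ^ 2)) ≤ 2 * (B / A) * Z * (E * S) := by
    have h4 : (2 * n + 1) * (4 * B / A * (E * S) ^ 2)
        ≤ (√(2 * L + 1) * (2 * (B / A)) * (E * S)) ^ 2 := by
      rw [mul_pow _ (E * S), mul_pow √(2 * L + 1), Real.sq_sqrt (by linarith)]
      have h5 : 4 * B / A ≤ (2 * (B / A)) ^ 2 := by
        rw [show 4 * B / A = 4 * (B / A) by ring]; nlinarith
      have h6 : 0 ≤ 2 * L + 1 := by linarith
      rw [mul_assoc]
      gcongr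
    calc _ ≤ √(2 * L + 1) * (2 * (B / A)) * (E * S) :=
          (Real.sqrt_le_sqrt h4).trans_eq (Real.sqrt_sq (by positivity))
      _ ≤ Z * (2 * (B / A)) * (E * S) := by gcongr
      _ = _ := by ring
  have e : S * ((A + 2 * B) / A * Z) * E = S * E * Z + 2 * (B / A) * Z * (E * S) := by
    field_simp
  rw [e]
  have h6 : S * E * √(2 + √(Real.pi / (2 * P / L ^ 2))) ≤ S * E * Z := by gcongr
  linarith

/-! ### The reconstruction error -/

/-- The truncation and frame-inversion error of the reconstruction. -/
theorem norm_mollify_sub_filterRecon_le {f : ℝ → ℝ} {ξ : ℝ} (hξ : ξ ∈ Set.Ioo (0 : ℝ) 1)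
    (hf : IsPiecewiseAnalytic f ξ) {lam : ℤ → ℝ} {A B c₀ : ℝ} (hF : IsFourierFrame lam A B)
    (ha : IsAdmissible lam c₀) {α κ : ℝ} (hα : 0 < α) (hκ : 0 < κ) (hακ : α * κ ≤ 4 / 7)
    (hr : κ / α ≤ A ^ 2 / (2 * (A + 2 * c₀ ^ 2) ^ 2)) {m : ℕ} (hn : 1 ≤ modes A c₀ m) {x : ℝ}
    (hx : x ∈ Set.Icc (0 : ℝ) 1) (hne : x ≠ ξ) :
    ‖mollify m (orderX κ ξ m x) (gammaX α ξ m x) f x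
        - filterRecon lam m (modes A c₀ m) α κ ξ f x‖
      ≤ supNorm f * ((A + 2 * B) / (A * √(2 * Real.pi * κ * jumpDist ξ x * m))) *
          (2 * A * m / (A + 2 * c₀ ^ 2) + 1) *
          Real.exp (-((rateTheta A c₀ α κ - 1 - Real.log (rateTheta A c₀ α κ)) * κ *
            jumpDist ξ x * m)) := by
  have hA := hF.1
  have hc := ha.1
  have hD : 0 < A + 2 * c₀ ^ 2 := by positivity
  have hd := jumpDist_pos hξ hx hne
  have hd2 := jumpDist_le_half ξ x
  have hnL : (modes A c₀ m : ℝ) ≤ modeBound A c₀ m :=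
    Nat.floor_le (by unfold modeBound; positivity)
  have hLn : modeBound A c₀ m < (modes A c₀ m : ℝ) + 1 := Nat.lt_floor_add_one _
  have hn1 : (1 : ℝ) ≤ modes A c₀ m := by exact_mod_cast hn
  have hL1 : 1 ≤ modeBound A c₀ m := hn1.trans hnL
  have hm : 1 ≤ m := by
    rcases Nat.eq_zero_or_pos m with rfl | h
    · simp only [modeBound, Nat.cast_zero, mul_zero, zero_div] at hL1
      linarith
    · exact h
  have hm0 : (0 : ℝ) < m := by exact_mod_cast hm
  have hL : modeBound A c₀ m = A / (A + 2 * c₀ ^ 2) * m := by unfold modeBound; ring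
  have hr' : κ / α ≤ (A / (A + 2 * c₀ ^ 2)) ^ 2 / 2 := by
    refine hr.trans_eq ?_
    rw [div_pow, div_div, mul_comm 2]
  have hPL := order_sq_le (m := m) hα hκ hd.le hd2 hακ hr'
  rw [← hL] at hPL
  have hP : 0 < κ * jumpDist ξ x * m := by positivity
  have hθL : rateTheta A c₀ α κ * (modeBound A c₀ m ^ 2)⁻¹ = α / (2 * κ * m ^ 2) := by
    unfold rateTheta modeBound
    field_simp
  have hθ : 1 ≤ rateTheta A c₀ α κ := by
    unfold rateTheta
    rw [div_le_div_iff₀ hα (by positivity)] at hr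
    rw [one_le_div (by positivity)]
    linarith
  have hγ : 0 < gammaX α ξ m x := Real.sqrt_pos.2 (by positivity)
  have hγ2 : gammaX α ξ m x ^ 2 = α * jumpDist ξ x * m := Real.sq_sqrt (by positivity)
  have hp : (orderX κ ξ m x : ℝ) ≤ κ * jumpDist ξ x * m := Nat.floor_le hP.le
  have hfin := hf.memLp_top hξ
  have hfS := integral_sq_le_supNorm hfin
  have hf1 : IntegrableOn f (Set.Ioc (0 : ℝ) 1) :=
    IntegrableOn.mono_set (hfin.integrable le_top) Set.Ioc_subset_Icc_self
  have hf2 : MemLp (fun y => (f y : ℂ)) 2 (volume.restrict (Set.Ioc (0 : ℝ) 1)) :=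
    ((hfin.mono_exponent le_top).ofReal).mono_measure
      (Measure.restrict_mono Set.Ioc_subset_Icc_self le_rfl)
  have hS : 0 ≤ supNorm f := ENNReal.toReal_nonneg
  have hs := hasSum_mollify hf1 hm (orderX κ ξ m x) hγ
  unfold filterRecon
  set L := modeBound A c₀ m
  set n := modes A c₀ m
  set θ := rateTheta A c₀ α κ
  set d := jumpDist ξ x
  set p := orderX κ ξ m x
  set γ := gammaX α ξ m x
  set S := supNorm f
  set h := mollify m p γ f
  set E := Real.exp (-(κ * d * m * (θ - 1 - Real.log θ))) with hE
  have hE0 : 0 < E := Real.exp_pos _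
  set σ : ℤ → ℝ := fun l => hdafFilter p (l * (γ / m)) with hσdef
  have hσ0 : ∀ l, 0 ≤ σ l := fun l => hdafFilter_nonneg _ _
  have hσs : Summable fun l => ‖(σ l : ℂ) * ip (fun y => (f y : ℂ)) (expo l)‖ := by
    -- by Bessel's inequality the Fourier coefficients of `f` are bounded by `‖f‖_∞`
    have h1 := hasSum_sq_ip hf2
    refine Summable.of_nonneg_of_le (fun _ => norm_nonneg _) (fun l => ?_)
      ((summable_hdafFilter p (b := γ / m) (by positivity)).mul_right S)
    rw [norm_mul, Complex.norm_real, Real.norm_of_nonneg (hσ0 l)]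
    refine mul_le_mul_of_nonneg_left ?_ (hσ0 l)
    exact (sq_le_sq₀ (norm_nonneg _) hS).1
      ((le_hasSum h1 l fun _ _ => sq_nonneg _).trans hfS)
  have hσ : ∀ l : ℤ, n < l.natAbs →
      σ l ≤ E * Real.exp (-(κ * d * m * ((l.natAbs : ℝ) / L - 1) ^ 2)) := by
    intro l hl
    have hl1 : (n : ℝ) + 1 ≤ l.natAbs := by exact_mod_cast hl
    refine hdafFilter_le_gaussian hP.le hp hθ ((one_le_div (by linarith)).2 (by linarith)) ?_
    have hl2 : (l.natAbs : ℝ) ^ 2 = (l : ℝ) ^ 2 := by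
      rw [Nat.cast_natAbs, Int.cast_abs, sq_abs]
    rw [div_pow, hl2, mul_div_assoc' θ, mul_comm θ, mul_div_assoc, div_eq_mul_inv θ, hθL, mul_pow,
      div_pow, hγ2]
    field_simp
  have hσE : ∀ l : ℤ, n < l.natAbs → σ l ≤ E := fun l hl => (hσ l hl).trans
    (mul_le_of_le_one_right hE0.le (Real.exp_le_one_iff.2 (by
      have := hP.le
      exact neg_nonpos.2 (by positivity))))
  have hh : Continuous h := continuous_of_hasSum_expo hσs hs
  have hrec := norm_sub_recon_le hF ha hn hh x
  have hT := norm_sub_proj_le hf2 hσ0 hσs hs hfS hS hE0.le (by linarith : 0 < L) hLn hP hσ x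
  have hI := integral_sq_sub_proj_le hf2 hσ0 hσs hs hfS hσE
  have hAB := hF.le_bound
  have hB := hF.2.1
  obtain ⟨hZ1, hZ2⟩ := sqrt_bounds hL1 hP hPL
  have hfinal := truncation_bound (P := κ * d * m) (S := S) (E := E) hA hAB hnL hS hE0.le
    (Nat.cast_nonneg n) hZ1 hZ2
  have hI2 : √((2 * (n : ℝ) + 1) * (4 * B / A
      * ∫ x in (0 : ℝ)..1, ‖h x - (proj n h : ℝ → ℂ) x‖ ^ 2))
      ≤ √((2 * (n : ℝ) + 1) * (4 * B / A * (E * S) ^ 2)) := by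
    refine Real.sqrt_le_sqrt ?_
    gcongr
  refine hrec.trans ((add_le_add hT hI2).trans (hfinal.trans_eq ?_))
  have e1 : 2 * Real.pi * (κ * d * m) = 2 * Real.pi * κ * d * m := by ring
  have e2 : -(κ * d * m * (θ - 1 - Real.log θ)) = -((θ - 1 - Real.log θ) * κ * d * m) := by ring
  have e3 : 2 * A * m / (A + 2 * c₀ ^ 2) = 2 * L := by
    change _ = 2 * modeBound A c₀ m
    unfold modeBound
    ring
  rw [hE, e1, e2, e3, ← div_div]
  ring

/-- The rate `η^{-κ d m}` is at least as good as `τ^{-d m}`, since `τ ≤ η^κ`. -/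
theorem rpow_neg_le_rateTau {η α κ d : ℝ} (hη : 1 < η) (hd : 0 ≤ d) {m : ℕ} (hm : 1 ≤ m) :
    η ^ (-(κ * d * m)) ≤ (m : ℝ) ^ (9 / 4 : ℝ) * rateTau η α κ ^ (-(m * d)) := by
  have hη0 : 0 < η := by linarith
  have hm1 : (1 : ℝ) ≤ m := by exact_mod_cast hm
  have hτ : 0 < rateTau η α κ := lt_min (by positivity) (by positivity)
  have h1 : η ^ (-(κ * d * m)) = (η ^ κ) ^ (-(m * d)) := by
    rw [← Real.rpow_mul hη0.le]
    congr 1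
    ring
  rw [h1]
  have h2 : (η ^ κ) ^ (-(m * d)) ≤ rateTau η α κ ^ (-(m * d)) :=
    Real.rpow_le_rpow_of_nonpos hτ (min_le_left _ _) (by
      exact neg_nonpos.2 (by positivity))
  have h3 : (1 : ℝ) ≤ (m : ℝ) ^ (9 / 4 : ℝ) := Real.one_le_rpow hm1 (by norm_num)
  exact h2.trans (le_mul_of_one_le_left (by positivity) h3)

end FourierRecon

end

theorem mainTheorem1 (f : ℝ → ℝ) (ξ : ℝ) (hξ : ξ ∈ Set.Ioo (0 : ℝ) 1)
    (hf : FourierRecon.IsPiecewiseAnalytic f ξ) :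
    ∃ C η : ℝ, 0 < C ∧ 1 < η ∧
      ∀ (lam : ℤ → ℝ) (A B c₀ : ℝ),
        FourierRecon.IsFourierFrame lam A B → FourierRecon.IsAdmissible lam c₀ →
      ∀ α κ : ℝ, 0 < α → 0 < κ →
        α * κ < 1 / (2 * Real.log (1 + √2)) →
        κ / α ≤ A ^ 2 / (2 * (A + 2 * c₀ ^ 2) ^ 2) →
      ∀ m : ℕ, 1 ≤ FourierRecon.modes A c₀ m →
        IsUnit (FourierRecon.frameOp lam m (FourierRecon.modes A c₀ m)) ∧
        ∀ x ∈ Set.Icc (0 : ℝ) 1, x ≠ ξ →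
          ‖(f x : ℂ) - FourierRecon.filterRecon lam m (FourierRecon.modes A c₀ m) α κ ξ f x‖ ≤
            C * (m : ℝ) ^ (9 / 4 : ℝ) *
                FourierRecon.rateTau η α κ ^ (-(m * FourierRecon.jumpDist ξ x)) +
              FourierRecon.supNorm f *
                ((A + 2 * B) / (A * √(2 * Real.pi * κ * FourierRecon.jumpDist ξ x * m))) *
                (2 * A * m / (A + 2 * c₀ ^ 2) + 1) *
                Real.exp (-((FourierRecon.rateTheta A c₀ α κ - 1 -
                  Real.log (FourierRecon.rateTheta A c₀ α κ)) * κ *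
                    FourierRecon.jumpDist ξ x * m)) := by
  obtain ⟨C, η, hC, hη, hmol⟩ := FourierRecon.exists_mollify_error hξ hf
  refine ⟨C, η, hC, hη, ?_⟩
  intro lam A B c₀ hF ha α κ hα hκ hακ hr m hn
  refine ⟨FourierRecon.isUnit_frameOp hF ha hn, fun x hx hne => ?_⟩
  have hακ' : α * κ ≤ 4 / 7 := by
    have h := FourierRecon.seven_eighths_le_log
    refine hακ.le.trans ?_
    rw [div_le_div_iff₀ (by linarith) (by norm_num)]
    linarith
  have hm : 1 ≤ m := by
    rcases Nat.eq_zero_or_pos m with rfl | h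
    · simp [FourierRecon.modes, FourierRecon.modeBound] at hn
    · exact h
  have h1 := hmol α κ hα hκ (by linarith) m hm x hx hne
  have h2 := FourierRecon.norm_mollify_sub_filterRecon_le hξ hf hF ha hα hκ hακ' hr hn hx hne
  have h3 := FourierRecon.rpow_neg_le_rateTau (α := α) (κ := κ) hη
    (FourierRecon.jumpDist_pos hξ hx hne).le hm
  refine (norm_sub_le_norm_sub_add_norm_sub _ _ _).trans (add_le_add (h1.trans ?_) h2)
  exact (mul_le_mul_of_nonneg_left h3 hC.le).trans_eq (by ring)
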